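/- Let $t\ge 5$ be prime, and write $q=e^{2\pi i z}$ for $z$ in the upper half plane $\mathcal H$. Let $\eta(z)=q^{1/24}\prod_{n\ge1}(1-q^n)$, $E_2(z)=1-24\sum_{n\ge1}\sigma_1(n)q^n$ with $\sigma_1(n)=\sum_{d\mid n}d$, and $$\mathcal E_{2,t}(z)=\frac{1}{t-1}\bigl(tE_2(tz)-E_2(z)\bigr).$$ Let $\chi_{12}(n)=1$ if $n\equiv\pm1\pmod{12}$, $\chi_{12}(n)=-1$ if $n\equiv\pm5\pmod{12}$, and $\chi_{12}(n)=0$ otherwise, and let $\left(\frac{\cdot}{t}\right)$ be the Legendre symbol. A weakly holomorphic modular form of weight $k\in\mathbb Z$ on $\Gamma_0(t)$ is a holomorphic function $f:\mathcal H\to\mathbb C$ such that $(cz+d)^{-k}f\left(\frac{az+b}{cz+d}\right)=f(z)$ for all $\begin{pmatrix}a&b\\c&d\end{pmatrix}\in\Gamma_0(t)$ and such that $f$ has at most polar singularities in the local variables at the cusps; for $k=0$ it is called a weakly holomorphic modular function. Let $K$ be a weakly holomorphic modular function on $\Gamma_0(t)$, and put $K^*(z)=K\left(-\frac{1}{tz}\right)$,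 that is, $K^*=K\mid W_t$ in weight $0$ with $W_t=\begin{pmatrix}0&-1\\t&0\end{pmatrix}$. Then there are an integer $m$ and coefficients $\beta_t(n)$ with $$\mathcal E_{2,t}(z)\,\frac{K(z)}{\eta(z)}=\sum_{n=m}^{\infty}\beta_t(n)\,q^{n-\frac1{24}}\qquad(z\in\mathcal H),$$ and for the coefficients of any such expansion the series $\sum_{n\ge m}\left(\frac{1-24n}{t}\right)\beta_t(n)q^{n-\frac1{24}}$ converges absolutely on $\mathcal H$ and the function $$S(z)=\mathcal E_{2,t}(tz)\,K^*(tz)\,\frac{\eta(z)}{\eta(t^2z)}-\chi_{12}(t)\,\eta(z)\sum_{n=m}^{\infty}\left(\frac{1-24n}{t}\right)\beta_t(n)\,q^{n-\frac1{24}}$$ is a weakly holomorphic modular form of weight $2$ on $\Gamma_0(t)$. -/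

import Mathlib

open scoped MatrixGroups ModularForm Manifold UpperHalfPlane Real

noncomputable section

namespace AtkinWeightTwo

/-- The weight `k` slash operator `(f ∣ L)(z) = (det L)^(k/2) (c z + d)^(-k) f(L z)` of a real
matrix `L = (a b; c d)` of positive determinant, with the normalisation `(det L)^(k/2)`. -/
def slash (k : ℤ) (L : GL(2, ℝ)⁺) (f : ℍ → ℂ) (z : ℍ) : ℂ :=
  ((((L : GL (Fin 2) ℝ).det : ℝ) ^ ((k : ℝ) / 2) : ℝ) : ℂ) *
    UpperHalfPlane.denom (L : GL (Fin 2) ℝ) z ^ (-k) * f (L • z)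

/-- On `SL(2, ℤ)` this is Mathlib's slash action. -/
theorem slash_eq_slash (k : ℤ) (γ : SL(2, ℤ)) (f : ℍ → ℂ) :
    slash k (γ : GL(2, ℝ)⁺) f = f ∣[k] γ := by
  ext z
  rw [ModularForm.SL_slash_apply]
  have h : (((γ : GL(2, ℝ)⁺) : GL (Fin 2) ℝ).det : ℝ) = 1 :=
    congrArg Units.val (Matrix.SpecialLinearGroup.coe_to_GLPos_to_GL_det _)
  rw [slash, h, Real.one_rpow, Complex.ofReal_one, one_mul, mul_comm]
  rfl

/-- `f` has at most a pole at `i∞`: for some `h ≥ 1`, and for all `z` of large imaginary part,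
`f z` is a meromorphic function at `0` of the local variable `q_h = exp (2 π i z / h)`. -/
def IsMeromorphicAtImInfty (f : ℍ → ℂ) : Prop :=
  ∃ h : ℕ, 0 < h ∧ ∃ F : ℂ → ℂ, MeromorphicAt F 0 ∧
    ∀ᶠ z in UpperHalfPlane.atImInfty, f z = F (Function.Periodic.qParam (h : ℝ) (z : ℂ))

/-- Weakly holomorphic modular forms of weight `k` on a finite index subgroup `Γ` of `SL(2, ℤ)`:
holomorphic on `ℍ`, invariant under the weight `k` action of `Γ`, and with at most poles at the
cusps `γ ∞`, `γ ∈ SL(2, ℤ)`. -/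
structure IsWeaklyHolomorphicModularForm (Γ : Subgroup SL(2, ℤ)) (k : ℤ) (f : ℍ → ℂ) : Prop where
  holo : MDifferentiable 𝓘(ℂ) 𝓘(ℂ) f
  slash_eq : ∀ γ ∈ Γ, f ∣[k] γ = f
  meromorphic_at_cusps : ∀ γ : SL(2, ℤ), IsMeromorphicAtImInfty (f ∣[k] γ)

/-- The matrix `W_t = (0 -1; t 0)`. -/
def fricke (t : ℕ) [NeZero t] : GL(2, ℝ)⁺ :=
  ⟨Matrix.GeneralLinearGroup.mkOfDetNeZero !![0, -1; (t : ℝ), 0]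
      (by simpa [Matrix.det_fin_two] using NeZero.ne t), by
    have : (0 : ℝ) < t := by exact_mod_cast NeZero.pos t
    simpa [Matrix.mem_glpos, Matrix.GeneralLinearGroup.mkOfDetNeZero, Matrix.det_fin_two]
      using this⟩

/-- The point `n z` of the upper half plane, for `n ≥ 1`. -/
def scale (n : ℕ) [NeZero n] (z : ℍ) : ℍ :=
  (⟨(n : ℝ), Nat.cast_pos.mpr (NeZero.pos n)⟩ : {x : ℝ // 0 < x}) • z

/-- `K* = K ∣ W_t` in weight `0`. -/
def star (t : ℕ) [NeZero t] (K : ℍ → ℂ) : ℍ → ℂ := slash 0 (fricke t) K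

/-- Explicitly, `K*(z) = K(-1/(t z))`. -/
theorem star_apply (t : ℕ) [NeZero t] (K : ℍ → ℂ) (z : ℍ) :
    ∃ w : ℍ, (w : ℂ) = -1 / (t * z) ∧ star t K z = K w := by
  refine ⟨fricke t • z, ?_, by simp [star, slash]⟩
  rw [Subgroup.smul_def, UpperHalfPlane.coe_smul_of_det_pos (fricke t).2]
  simp [UpperHalfPlane.num, UpperHalfPlane.denom, fricke,
    Matrix.GeneralLinearGroup.mkOfDetNeZero]

/-- The weight `2` Eisenstein series `(t E₂(t z) - E₂(z)) / (t - 1)` on `Γ₀(t)`. -/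
def eisensteinTwo (t : ℕ) [NeZero t] (z : ℍ) : ℂ :=
  1 / ((t : ℂ) - 1) * (t * EisensteinSeries.E2 (scale t z) - EisensteinSeries.E2 z)

/-- The function `χ₁₂`: `1` at `±1 mod 12`, `-1` at `±5 mod 12`, and `0` elsewhere. -/
def chi12 (n : ℤ) : ℤ :=
  if n ≡ 1 [ZMOD 12] ∨ n ≡ -1 [ZMOD 12] then 1
  else if n ≡ 5 [ZMOD 12] ∨ n ≡ -5 [ZMOD 12] then -1
  else 0

/-- `q^(n - 1/24) = exp (2 π i (n - 1/24) z)`. -/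
def qPow (n : ℤ) (z : ℍ) : ℂ := Complex.exp (2 * π * Complex.I * ((n : ℂ) - 1 / 24) * z)

/-- `β` is the coefficient sequence of an expansion `f(z) = ∑_{n ≥ m} β(n) q^(n - 1/24)`, valid on
the whole upper half plane, with some starting index `m`; `β` is extended by `0` below `m`. -/
def HasExpansion (f : ℍ → ℂ) (β : ℤ → ℂ) : Prop :=
  (∃ m : ℤ, ∀ n < m, β n = 0) ∧ ∀ z : ℍ, HasSum (fun n : ℤ ↦ β n * qPow n z) (f z)

/-- The term `((1 - 24 n) / t) β(n) q^(n - 1/24)` of the twisted series. -/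
def twistedTerm (t : ℕ) [Fact t.Prime] (β : ℤ → ℂ) (z : ℍ) (n : ℤ) : ℂ :=
  (legendreSym t (1 - 24 * n) : ℂ) * β n * qPow n z

/-- The function
`S(z) = 𝓔_{2,t}(t z) K*(t z) η(z) / η(t² z) - χ₁₂(t) η(z) ∑ ((1 - 24 n)/t) β(n) q^(n - 1/24)`. -/
def S (t : ℕ) [Fact t.Prime] (K : ℍ → ℂ) (β : ℤ → ℂ) (z : ℍ) : ℂ :=
  eisensteinTwo t (scale t z) * star t K (scale t z) *
      (ModularForm.eta z / ModularForm.eta ((t : ℂ) ^ 2 * z)) -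
    (chi12 t : ℂ) * ModularForm.eta z * ∑' n : ℤ, twistedTerm t β z n

end AtkinWeightTwo

end

noncomputable section

namespace AtkinWeightTwo

open Filter Topology

/-! ### The pentagonal number theorem and the theta series of `η` -/

/-! Put G = 𝓔_{2,t}·K, a form of weight 2 on Γ₀(t), and let χ be the Legendre symbol modulo t. A
Gauss sum turns the twist of G/η by χ into a weighted average of its values at z + 24a/t
(`hasSum_twistedTerm`). In terms of w = tz, the function S is therefore built from translates of G
and η by matrices of determinant t, and these are indexed by the lines spanned by nonzero row
vectors v modulo t.

The translates of G satisfy G_v ∣ γ = G_{vγ} (`formShift_slash`). Those of η, normalised by Legendre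
symbols and one Gauss-sum constant, satisfy η_v(γz) = j(z) η_{vγ}(z), where j depends on γ but not
on v (`exists_etaVec_smul`). The deep case is γ = S. By the pentagonal number theorem 2η is the
theta series of χ₁₂, so η((z + 24a)/t) is a theta series with coefficients periodic modulo 12t;
Poisson summation reduces its inversion to Gauss sums modulo 12 and t (`etaShift_neg_inv`).

Since j cancels in η_{(1,0)}/η_v, the sum Σ χ(v₁) G_v η_{(1,0)}/η_v is merely permuted by SL(2, ℤ),
apart from the weights χ(v₁) and the vector (1,0). Matrices with upper right entry divisible by t
change these by χ(d) and χ(a), whose product is 1 (`shiftSum_slash_eq_self`). Replacing z by tz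
moves the invariance to Γ₀(t). Rows with v₀ ≠ 0 give the twisted series; rows with v₀ = 0 give the
term in K*, because W_t sends 𝓔_{2,t} to its negative (`S_eq_shiftSum`). At each cusp the sum is a
finite combination of quotients of functions meromorphic in a local variable, with no zeros of η
inside ℍ. -/

theorem norm_prod_one_sub_pow_le {x : ℂ} (hx : ‖x‖ < 1) (k n : ℕ) :
    ‖∏ i ∈ Finset.range n, (1 - x ^ (k + i + 1))‖ ≤ Real.exp (1 - ‖x‖)⁻¹ := by
  calc ‖∏ i ∈ Finset.range n, (1 - x ^ (k + i + 1))‖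
      = ∏ i ∈ Finset.range n, ‖1 - x ^ (k + i + 1)‖ := norm_prod _ _
    _ ≤ ∏ i ∈ Finset.range n, Real.exp (‖x‖ ^ i) := by
        refine Finset.prod_le_prod (fun _ _ ↦ norm_nonneg _) fun i _ ↦ ?_
        calc ‖1 - x ^ (k + i + 1)‖ ≤ ‖x‖ ^ (k + i + 1) + 1 := by
              simpa [add_comm] using norm_sub_le 1 (x ^ (k + i + 1))
          _ ≤ ‖x‖ ^ i + 1 := by
              gcongr ?_ + 1
              exact pow_le_pow_of_le_one (norm_nonneg _) hx.le (by omega)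
          _ ≤ _ := Real.add_one_le_exp _
    _ = Real.exp (∑ i ∈ Finset.range n, ‖x‖ ^ i) := (Real.exp_sum _ _).symm
    _ ≤ _ := by
        gcongr
        rw [← tsum_geometric_of_lt_one (norm_nonneg _) hx]
        exact (summable_geometric_of_lt_one (norm_nonneg _) hx).sum_le_tsum _
          fun _ _ ↦ by positivity

/-- The majorant is geometric in n and uniform in k. It gives both the summability for fixed k and
the vanishing of the remainder as k → ∞. -/
theorem norm_pow_mul_prod_one_sub_pow_le {x : ℂ} (hx : ‖x‖ < 1) (k n : ℕ) :
    ‖x ^ ((k + 1) * n) * ∏ i ∈ Finset.range (n + 1), (1 - x ^ (k + i + 1))‖ ≤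
      Real.exp (1 - ‖x‖)⁻¹ * ‖x‖ ^ n := by
  rw [norm_mul, norm_pow, mul_comm]
  refine mul_le_mul (norm_prod_one_sub_pow_le hx k _)
    (pow_le_pow_of_le_one (norm_nonneg _) hx.le ?_) (by positivity) (by positivity)
  nlinarith

theorem summable_pow_pentagonal_neg {x : ℂ} (hx : ‖x‖ < 1) :
    Summable fun k : ℤ ↦ (k.negOnePow : ℂ) * x ^ pentagonal (-k) := by
  have h : Summable fun k : ℤ ↦ ‖x‖ ^ pentagonal (-k) :=
    (summable_geometric_of_lt_one (norm_nonneg x) hx).comp_injective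
      (pentagonal_injective.comp neg_injective)
  refine Summable.of_norm (h.congr fun k ↦ ?_)
  rcases Int.even_or_odd k with hk | hk <;> simp [Int.negOnePow_even, Int.negOnePow_odd, hk]

/-- The pentagonal number theorem on the open unit disc. -/
theorem hasSum_pentagonal {x : ℂ} (hx : ‖x‖ < 1) :
    HasSum (fun k : ℤ ↦ (k.negOnePow : ℂ) * x ^ pentagonal (-k)) (∏' n : ℕ, (1 - x ^ (n + 1))) := by
  have hs := summable_pow_pentagonal_neg hx
  have hnat : HasSum (fun k : ℕ ↦ (-1 : ℂ) ^ k * (x ^ pentagonal (-k) - x ^ pentagonal (k + 1)))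
      (∑' k : ℤ, (k.negOnePow : ℂ) * x ^ pentagonal (-k)) := by
    convert hs.hasSum.nat_add_neg_add_one using 2 with k
    simp [Int.negOnePow_add, Int.negOnePow_neg]
    ring
  have hgeom := summable_geometric_of_lt_one (norm_nonneg x) hx
  have hsum (k : ℕ) : Summable fun n : ℕ ↦
      x ^ ((k + 1) * n) * ∏ i ∈ Finset.range (n + 1), (1 - x ^ (k + i + 1)) :=
    (hgeom.mul_left _).of_norm_bounded (norm_pow_mul_prod_one_sub_pow_le hx k)
  have hprod : ∏' n : ℕ, (1 - x ^ (n + 1)) =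
      ∑' k : ℕ, (-1 : ℂ) ^ k * (x ^ pentagonal (-k) - x ^ pentagonal (k + 1)) := by
    refine Pentagonal.tprod_one_sub_pow (tendsto_pow_atTop_nhds_zero_of_norm_lt_one hx) hsum
      (fun k ↦ ?_) hnat.summable ?_
    · refine multipliable_one_add_of_summable (f := fun n ↦ -x ^ (n + k + 1)) ?_
      simpa [add_assoc] using (summable_nat_add_iff (k + 1)).mpr hgeom
    -- The remainder carries a power of x with exponent at least k, times a series bounded
    -- independently of k.
    · refine squeeze_zero_norm (a := fun k ↦ ‖x‖ ^ k *
        ∑' n : ℕ, Real.exp (1 - ‖x‖)⁻¹ * ‖x‖ ^ n) (fun k ↦ ?_) ?_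
      · rw [norm_mul, norm_mul, norm_pow, norm_neg, norm_one, one_pow, one_mul, norm_pow]
        refine mul_le_mul (pow_le_pow_of_le_one (norm_nonneg _) hx.le ?_)
          (tsum_of_norm_bounded (hgeom.mul_left _).hasSum
            (norm_pow_mul_prod_one_sub_pow_le hx k)) (norm_nonneg _) (by positivity)
        rw [Nat.le_div_iff_mul_le two_pos]
        nlinarith
      · simpa using (tendsto_pow_atTop_nhds_zero_of_lt_one (norm_nonneg _) hx).mul_const
          (∑' n : ℕ, Real.exp (1 - ‖x‖)⁻¹ * ‖x‖ ^ n)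
  rw [hprod, hnat.tsum_eq]
  exact hs.hasSum

/-! ### The character χ₁₂ and η as a theta series. -/

theorem chi12_six_mul_add_one (k : ℤ) : chi12 (6 * k + 1) = k.negOnePow := by
  rcases Int.even_or_odd' k with ⟨m, rfl | rfl⟩
  · rw [Int.negOnePow_even _ (by simp), chi12, if_pos (by left; simp [Int.modEq_iff_dvd]; omega)]
    rfl
  · rw [Int.negOnePow_odd _ (by simp), chi12, if_neg (by simp [Int.modEq_iff_dvd]; omega),
      if_pos (by simp [Int.modEq_iff_dvd]; omega)]
    rfl

theorem chi12_neg (n : ℤ) : chi12 (-n) = chi12 n := by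
  simp only [chi12, Int.modEq_iff_dvd]
  congr 1
  · simp only [eq_iff_iff]; omega
  · congr 1; simp only [eq_iff_iff]; omega

theorem chi12_eq_zero {n : ℤ} (h1 : ¬ n ≡ 1 [ZMOD 6]) (h2 : ¬ n ≡ -1 [ZMOD 6]) : chi12 n = 0 := by
  simp only [Int.modEq_iff_dvd] at h1 h2
  rw [chi12, if_neg (by simp [Int.modEq_iff_dvd]; omega),
    if_neg (by simp [Int.modEq_iff_dvd]; omega)]

/-- The pentagonal exponent k(3k + 1)/2 satisfies 24·k(3k + 1)/2 + 1 = (6k + 1)², and the sign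
(-1)^k is χ₁₂(6k + 1). -/
theorem hasSum_eta {z : ℂ} (hz : 0 < z.im) :
    HasSum (fun k : ℤ ↦ (chi12 (6 * k + 1) : ℂ) *
      Complex.exp (π * Complex.I * ((6 * k + 1 : ℤ) : ℂ) ^ 2 * z / 12)) (ModularForm.eta z) := by
  have hq : ‖Function.Periodic.qParam 1 z‖ < 1 := Function.Periodic.norm_qParam_lt_one one_pos hz
  refine ((hasSum_pentagonal hq).mul_left (Function.Periodic.qParam 24 z)).congr_fun fun k ↦ ?_
  rw [chi12_six_mul_add_one, mul_left_comm]
  congr 1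
  rw [Function.Periodic.qParam, Function.Periodic.qParam, ← Complex.exp_nat_mul, ← Complex.exp_add]
  congr 1
  have h := congrArg (Int.cast (R := ℂ)) (two_mul_natCast_pentagonal_neg k)
  push_cast at h ⊢
  linear_combination (-π * Complex.I * z) * h

/-- `2 η(z) = ∑ χ₁₂(n) q^(n²/24)`, the sum being over all integers. -/
theorem hasSum_two_mul_eta {z : ℂ} (hz : 0 < z.im) :
    HasSum (fun n : ℤ ↦ (chi12 n : ℂ) * Complex.exp (π * Complex.I * (n : ℂ) ^ 2 * z / 12))
      (2 * ModularForm.eta z) := by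
  set F : ℤ → ℂ := fun n ↦ (chi12 n : ℂ) * Complex.exp (π * Complex.I * (n : ℂ) ^ 2 * z / 12)
    with hF
  -- The class 1 mod 6 already gives η; the class -1 gives it again because χ₁₂ is even. Using both
  -- makes the coefficients periodic modulo 12, as Poisson summation requires.
  have h1 : HasSum (fun n : ℤ ↦ if n ≡ 1 [ZMOD 6] then F n else 0) (ModularForm.eta z) := by
    have hinj : Function.Injective fun k : ℤ ↦ 6 * k + 1 := fun a b h ↦ by simpa using h
    rw [← hinj.hasSum_iff]
    · refine (hasSum_eta hz).congr_fun fun k ↦ ?_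
      rw [Function.comp_apply, if_pos (by simp [Int.modEq_iff_dvd])]
    · intro n hn
      refine if_neg fun h ↦ hn ?_
      obtain ⟨m, hm⟩ := (Int.modEq_iff_dvd.mp h)
      exact ⟨-m, by simp only; omega⟩
  have hneg : ∀ n, F (-n) = F n := fun n ↦ by simp [hF, chi12_neg]
  have h2 : HasSum (fun n : ℤ ↦ if n ≡ -1 [ZMOD 6] then F n else 0) (ModularForm.eta z) := by
    rw [← neg_injective.hasSum_iff fun n hn ↦ (hn ⟨-n, neg_neg n⟩).elim]
    refine h1.congr_fun fun n ↦ ?_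
    simp only [Function.comp_apply, hneg]
    congr 1
    simp only [Int.modEq_iff_dvd, eq_iff_iff]
    omega
  rw [two_mul]
  refine (h1.add h2).congr_fun fun n ↦ ?_
  by_cases ha : n ≡ 1 [ZMOD 6]
  · rw [if_pos ha, if_neg, add_zero]
    simp only [Int.modEq_iff_dvd] at ha ⊢
    omega
  · by_cases hb : n ≡ -1 [ZMOD 6]
    · rw [if_neg ha, if_pos hb, zero_add]
    · simp [ha, hb, hF, chi12_eq_zero ha hb]

/-! ### Poisson summation for theta series with periodic coefficients -/

/-- For r > 0 the principal logarithm satisfies log(rw) = log r + log w, so no sign of the square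
root is lost. -/
theorem neg_I_mul_ofReal_mul_cpow {r : ℝ} (hr : 0 < r) {z : ℂ} (hz : z ≠ 0) :
    (-Complex.I * (r * z)) ^ (1 / 2 : ℂ) = (√r : ℂ) * (-Complex.I * z) ^ (1 / 2 : ℂ) := by
  have h0 : -Complex.I * z ≠ 0 := by simp [hz]
  have hrz : -Complex.I * (r * z) = r * (-Complex.I * z) := by ring
  have hr' : (r : ℂ) ≠ 0 := by exact_mod_cast hr.ne'
  rw [hrz, Complex.cpow_def_of_ne_zero (mul_ne_zero hr' h0), Complex.cpow_def_of_ne_zero h0,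
    Complex.log_ofReal_mul hr h0, add_mul, Complex.exp_add, Real.sqrt_eq_rpow,
    Complex.ofReal_cpow hr.le, Complex.cpow_def_of_ne_zero hr', Complex.ofReal_log hr.le]
  norm_num

/-- Writing n = r + Nk and expanding the square separates a constant factor from a Jacobi theta
series in k. -/
theorem hasSum_theta_residue (N : ℕ) [NeZero N] (c : ℂ) (r : ZMod N) {z : ℂ} (hz : 0 < z.im) :
    HasSum (fun n : ℤ ↦ if (n : ZMod N) = r then
        c * Complex.exp (π * Complex.I * (n : ℂ) ^ 2 * z / N) else 0)
      (c * Complex.exp (π * Complex.I * (r.val : ℂ) ^ 2 * z / N) *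
        jacobiTheta₂ (r.val * z) (N * z)) := by
  have hN : (N : ℂ) ≠ 0 := NeZero.ne _
  have hN' : (0 : ℝ) < N := by exact_mod_cast NeZero.pos N
  have hinj : Function.Injective fun k : ℤ ↦ (r.val : ℤ) + N * k := fun a b h ↦ by
    simpa [NeZero.ne N] using h
  rw [← hinj.hasSum_iff]
  · have him : 0 < ((N : ℂ) * z).im := by
      simpa using mul_pos hN' hz
    refine ((hasSum_jacobiTheta₂_term (r.val * z) him).mul_left _).congr_fun fun k ↦ ?_
    rw [Function.comp_apply, if_pos (by simp), mul_assoc c, jacobiTheta₂_term, ← Complex.exp_add]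
    congr 2
    push_cast
    field_simp
    ring
  · intro n hn
    refine if_neg fun h ↦ hn ?_
    have : ((n : ℤ) : ZMod N) = ((r.val : ℤ) : ZMod N) := by simpa using h
    obtain ⟨k, hk⟩ := (Int.modEq_iff_dvd.mp ((ZMod.intCast_eq_intCast_iff _ _ _).mp this))
    exact ⟨-k, by simp only; linarith⟩

/-- Poisson summation: the theta series of `f` at `z` is the theta series of the finite Fourier
transform of `f` at `-1/z`. -/
theorem hasSum_theta_transform (N : ℕ) [NeZero N] (f : ZMod N → ℂ) {z B : ℂ} (hz : 0 < z.im)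
    (hB : HasSum (fun n : ℤ ↦ (∑ r : ZMod N, f r * ZMod.stdAddChar (r * (n : ZMod N))) *
      Complex.exp (π * Complex.I * (n : ℂ) ^ 2 * (-1 / z) / N)) B) :
    HasSum (fun n : ℤ ↦ f n * Complex.exp (π * Complex.I * (n : ℂ) ^ 2 * z / N))
      (1 / (-Complex.I * (N * z)) ^ (1 / 2 : ℂ) * B) := by
  have hN : (N : ℂ) ≠ 0 := NeZero.ne _
  have hN' : (0 : ℝ) < N := by exact_mod_cast NeZero.pos N
  have hz0 : z ≠ 0 := by rintro rfl; simp at hz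
  have him : 0 < (-1 / (N * z)).im := by
    have h : 0 < ((N : ℂ) * z).im := by simpa using mul_pos hN' hz
    simpa using UpperHalfPlane.im_inv_neg_coe_pos ⟨_, h⟩ |>.trans_eq (by simp [neg_div])
  have hterm (r : ZMod N) : HasSum (fun n : ℤ ↦ f r * ZMod.stdAddChar (r * (n : ZMod N)) *
      Complex.exp (π * Complex.I * (n : ℂ) ^ 2 * (-1 / z) / N))
      (f r * jacobiTheta₂ ((r.val * z) / (N * z)) (-1 / (N * z))) := by
    refine ((hasSum_jacobiTheta₂_term _ him).mul_left (f r)).congr_fun fun n ↦ ?_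
    have hr : (r * n : ZMod N) = ((r.val * n : ℤ) : ZMod N) := by simp
    rw [mul_assoc, hr, ZMod.stdAddChar_coe, ← Complex.exp_add, jacobiTheta₂_term]
    congr 2
    push_cast
    field_simp
  have hBsum : B = ∑ r : ZMod N, f r * jacobiTheta₂ ((r.val * z) / (N * z)) (-1 / (N * z)) := by
    refine hB.unique ((hasSum_sum fun r _ ↦ hterm r).congr_fun fun n ↦ ?_)
    rw [Finset.sum_mul]
  have hA := hasSum_sum fun r (_ : r ∈ Finset.univ) ↦ hasSum_theta_residue N (f r) r hz
  convert! hA using 1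
  · ext n
    simp
  · rw [hBsum, Finset.mul_sum]
    refine Finset.sum_congr rfl fun r _ ↦ ?_
    rw [jacobiTheta₂_functional_equation (r.val * z) (N * z)]
    -- The Gaussian factor in the functional equation of `jacobiTheta₂` cancels the constant factor
    -- of the residue class.
    have he : Complex.exp (π * Complex.I * (r.val : ℂ) ^ 2 * z / N) *
        Complex.exp (-π * Complex.I * (r.val * z) ^ 2 / (N * z)) = 1 := by
      rw [← Complex.exp_add, Complex.exp_eq_one_iff]
      refine ⟨0, ?_⟩
      field_simp
      simp
    linear_combination (-(f r * (1 / (-Complex.I * (N * z)) ^ (1 / 2 : ℂ)) *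
      jacobiTheta₂ ((r.val * z) / (N * z)) (-1 / (N * z)))) * he

/-! ### Gauss sums -/

/-! ### Gauss sums modulo 12 and the inversion of η. -/

/-- `χ₁₂` as a function on `ℤ/12ℤ`. -/
def chi12Mod (r : ZMod 12) : ℤ := if r = 1 ∨ r = -1 then 1 else if r = 5 ∨ r = -5 then -1 else 0

theorem chi12_eq_chi12Mod (n : ℤ) : chi12 n = chi12Mod n := by
  have h (m : ℤ) : n ≡ m [ZMOD 12] ↔ (n : ZMod 12) = (m : ZMod 12) :=
    (ZMod.intCast_eq_intCast_iff n m 12).symm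
  simp only [chi12, chi12Mod, h]
  push_cast
  rfl

theorem chi12Mod_mul (a b : ZMod 12) : chi12Mod (a * b) = chi12Mod a * chi12Mod b := by
  revert a b
  decide

theorem chi12_mul (a b : ℤ) : chi12 (a * b) = chi12 a * chi12 b := by
  simp only [chi12_eq_chi12Mod, Int.cast_mul, chi12Mod_mul]

theorem chi12_congr {a b : ℤ} (h : a ≡ b [ZMOD 12]) : chi12 a = chi12 b := by
  rw [chi12_eq_chi12Mod, chi12_eq_chi12Mod, (ZMod.intCast_eq_intCast_iff a b 12).mpr h]

theorem chi12_sq {t : ℕ} (ht : t.Coprime 12) : chi12 t ^ 2 = 1 := by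
  rw [chi12_eq_chi12Mod]
  have h : IsUnit ((t : ℤ) : ZMod 12) := by simpa using (ZMod.isUnit_iff_coprime t 12).mpr ht
  revert h
  generalize ((t : ℤ) : ZMod 12) = r
  revert r
  decide

theorem stdAddChar_twelve_one :
    (ZMod.stdAddChar (1 : ZMod 12) : ℂ) = (√3 + Complex.I) / 2 := by
  have h := ZMod.stdAddChar_coe (N := 12) 1
  rw [Int.cast_one] at h
  rw [h, show 2 * π * Complex.I * (1 : ℤ) / (12 : ℕ) = ((π / 6 : ℝ) : ℂ) * Complex.I by
    push_cast; ring, Complex.exp_mul_I, ← Complex.ofReal_cos, ← Complex.ofReal_sin,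
    Real.cos_pi_div_six, Real.sin_pi_div_six]
  push_cast
  ring

theorem sum_chi12Mod_mul_stdAddChar_one :
    ∑ r : ZMod 12, (chi12Mod r : ℂ) * ZMod.stdAddChar r = (√12 : ℝ) := by
  set ζ : ℂ := ZMod.stdAddChar (1 : ZMod 12) with hζ
  have h3 : ((√3 : ℝ) : ℂ) ^ 2 = 3 := by norm_cast; simp
  have h12 : √12 = 2 * √3 := by
    rw [show (12 : ℝ) = 2 ^ 2 * 3 by norm_num, Real.sqrt_mul (by positivity),
      Real.sqrt_sq (by positivity)]
  have hz : ζ = (√3 + Complex.I) / 2 := stdAddChar_twelve_one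
  have hz2 : ζ ^ 2 = (1 + √3 * Complex.I) / 2 := by
    rw [hz]; linear_combination h3 / 4 + Complex.I_sq / 4
  have hz3 : ζ ^ 3 = Complex.I := by
    rw [pow_succ, hz2, hz]; linear_combination Complex.I * h3 / 4 + √3 * Complex.I_sq / 4
  have hpow (n : ℕ) : ZMod.stdAddChar (n : ZMod 12) = ζ ^ n := by
    rw [hζ, ← AddChar.map_nsmul_eq_pow, nsmul_one]
  have h5 := hpow 5
  have h7 := hpow 7
  have h11 := hpow 11
  simp only [Nat.cast_ofNat] at h5 h7 h11
  rw [← Finset.sum_subset (Finset.subset_univ ({1, 5, 7, 11} : Finset (ZMod 12)))]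
  · rw [Finset.sum_insert (by decide), Finset.sum_insert (by decide),
      Finset.sum_insert (by decide), Finset.sum_singleton,
      show chi12Mod 1 = 1 by decide, show chi12Mod 5 = -1 by decide,
      show chi12Mod 7 = -1 by decide, show chi12Mod 11 = 1 by decide, h5, h7, h11, ← hζ,
      show ζ ^ 5 = ζ ^ 3 * ζ ^ 2 by ring, show ζ ^ 7 = (ζ ^ 3) ^ 2 * ζ by ring,
      show ζ ^ 11 = (ζ ^ 3) ^ 2 * ζ ^ 3 * ζ ^ 2 by ring, hz3, hz2, hz, h12]
    push_cast
    linear_combination (-√3 + √3 / 2 * (Complex.I ^ 2 - 1)) * Complex.I_sq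
  · intro r _ hr
    have : chi12Mod r = 0 := by revert r; decide
    simp [this]

/-- Substitute r ↦ rs. With s = m a unit this evaluates the transform at m; with sm = m and χ₁₂(s) =
-1 it forces the transform to vanish. -/
theorem sum_chi12Mod_mul_stdAddChar_mul {s : ZMod 12} (hs : s * s = 1) (m : ZMod 12) :
    ∑ r : ZMod 12, (chi12Mod r : ℂ) * ZMod.stdAddChar (r * (s * m)) =
      chi12Mod s * ∑ r : ZMod 12, (chi12Mod r : ℂ) * ZMod.stdAddChar (r * m) := by
  have hinv : Function.Involutive (· * s) := fun r ↦ by simp [mul_assoc, hs]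
  rw [Finset.mul_sum]
  refine Fintype.sum_bijective _ hinv.bijective _ _ fun r ↦ ?_
  have h1 : chi12Mod s * chi12Mod s = 1 := by rw [← chi12Mod_mul, hs]; decide
  have h2 : (chi12Mod s : ℂ) * chi12Mod s = 1 := by exact_mod_cast h1
  rw [chi12Mod_mul, mul_assoc r s m]
  push_cast
  linear_combination (-(chi12Mod r : ℂ) * ZMod.stdAddChar (r * (s * m))) * h2

/-- `χ₁₂` is an eigenfunction of the finite Fourier transform. -/
theorem sum_chi12Mod_mul_stdAddChar (m : ZMod 12) :
    ∑ r : ZMod 12, (chi12Mod r : ℂ) * ZMod.stdAddChar (r * m) = (√12 : ℝ) * chi12Mod m := by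
  -- Every unit modulo 12 squares to 1, and every non-unit is fixed by some unit with χ₁₂ = -1.
  have h : m * m = 1 ∨ chi12Mod m = 0 ∧ ∃ s : ZMod 12, s * s = 1 ∧ chi12Mod s = -1 ∧ s * m = m := by
    revert m
    decide
  rcases h with h | ⟨h0, s, hs, hcs, hsm⟩
  · have := sum_chi12Mod_mul_stdAddChar_mul h 1
    simp only [mul_one, sum_chi12Mod_mul_stdAddChar_one] at this
    rw [this, mul_comm]
  · have := sum_chi12Mod_mul_stdAddChar_mul hs m
    rw [hsm, hcs] at this
    push_cast at this
    rw [h0, Int.cast_zero, mul_zero]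
    linear_combination this / 2

/-- The transformation of `η` under `z ↦ -1/z`. -/
theorem eta_neg_inv {z : ℂ} (hz : 0 < z.im) :
    ModularForm.eta (-1 / z) = (-Complex.I * z) ^ (1 / 2 : ℂ) * ModularForm.eta z := by
  have hz0 : z ≠ 0 := by rintro rfl; simp at hz
  have him : 0 < (-1 / z).im := by
    simpa [neg_div] using UpperHalfPlane.im_inv_neg_coe_pos ⟨z, hz⟩
  have hJ : (-Complex.I * z) ^ (1 / 2 : ℂ) ≠ 0 := by simp [Complex.cpow_eq_zero_iff, hz0]
  have h12 : ((√12 : ℝ) : ℂ) ≠ 0 := by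
    exact_mod_cast (Real.sqrt_pos.mpr (by norm_num : (0 : ℝ) < 12)).ne'
  -- The eigenvalue √12 of the Fourier transform will cancel the √12 in (-12iz)^(1/2).
  have h := hasSum_theta_transform 12 (fun r ↦ (chi12Mod r : ℂ)) hz
    (((hasSum_two_mul_eta him).mul_left ((√12 : ℝ) : ℂ)).congr_fun fun n ↦ by
      rw [sum_chi12Mod_mul_stdAddChar, chi12_eq_chi12Mod, mul_assoc]; norm_num)
  have h' := h.unique ((hasSum_two_mul_eta hz).congr_fun fun n ↦ by
    rw [chi12_eq_chi12Mod]; norm_num)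
  have hcs := neg_I_mul_ofReal_mul_cpow (by norm_num : (0 : ℝ) < 12) hz0
  rw [Nat.cast_ofNat, show (12 : ℂ) = ((12 : ℝ) : ℂ) by norm_num, hcs] at h'
  field_simp at h'
  rw [neg_div, neg_mul]
  exact h'

/-! ### Quadratic Gauss sums modulo t. -/

/-- The Legendre symbol modulo `t` as a complex valued multiplicative character. -/
def legendreChar (t : ℕ) [Fact t.Prime] : MulChar (ZMod t) ℂ :=
  (quadraticChar (ZMod t)).ringHomComp (Int.castRingHom ℂ)

/-- The quadratic Gauss sum modulo `t`. -/
def quadGauss (t : ℕ) [Fact t.Prime] : ℂ := gaussSum (legendreChar t) ZMod.stdAddChar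

section GaussSum

variable {t : ℕ} [Fact t.Prime]

theorem legendreChar_apply (a : ZMod t) : legendreChar t a = (quadraticChar (ZMod t) a : ℂ) := rfl

theorem legendreSym_eq_legendreChar (n : ℤ) : (legendreSym t n : ℂ) = legendreChar t n := rfl

theorem legendreChar_isQuadratic : (legendreChar t).IsQuadratic :=
  (quadraticChar_isQuadratic (ZMod t)).comp _

theorem legendreChar_ne_one (ht : t ≠ 2) : legendreChar t ≠ 1 :=
  (MulChar.ringHomComp_ne_one_iff (RingHom.injective_int _)).mpr
    (quadraticChar_ne_one (by rwa [ZMod.ringChar_zmod_n]))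

theorem legendreChar_mul_self {a : ZMod t} (ha : a ≠ 0) :
    legendreChar t a * legendreChar t a = 1 := by
  have := quadraticChar_sq_one ha
  rw [legendreChar_apply, ← pow_two]
  exact_mod_cast this

theorem legendreChar_ne_zero {a : ZMod t} (ha : a ≠ 0) : legendreChar t a ≠ 0 :=
  left_ne_zero_of_mul_eq_one (legendreChar_mul_self ha)

theorem legendreChar_inv (a : ZMod t) : legendreChar t a⁻¹ = legendreChar t a := by
  rcases eq_or_ne a 0 with rfl | ha
  · rw [inv_zero]
  · refine mul_right_cancel₀ (legendreChar_ne_zero ha) ?_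
    rw [← map_mul, inv_mul_cancel₀ ha, map_one, legendreChar_mul_self ha]

theorem quadGauss_sq (ht : t ≠ 2) : quadGauss t ^ 2 = legendreChar t (-1) * t := by
  have := gaussSum_sq (legendreChar_ne_one ht) legendreChar_isQuadratic
    (ZMod.isPrimitive_stdAddChar t)
  rwa [ZMod.card] at this

theorem quadGauss_ne_zero (ht : t ≠ 2) : quadGauss t ≠ 0 := by
  have h : quadGauss t ^ 2 ≠ 0 := by
    rw [quadGauss_sq ht]
    exact mul_ne_zero (legendreChar_ne_zero (by simp)) (NeZero.ne _)
  exact fun h0 ↦ h (by simp [h0])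

theorem sum_legendreChar_mul_stdAddChar (ht : t ≠ 2) (c : ZMod t) :
    ∑ a : ZMod t, legendreChar t a * ZMod.stdAddChar (c * a) = legendreChar t c * quadGauss t := by
  rcases eq_or_ne c 0 with rfl | hc
  · simpa [MulChar.map_zero] using MulChar.sum_eq_zero_of_ne_one (legendreChar_ne_one ht)
  · have h := gaussSum_mulShift_eq (legendreChar t) ZMod.stdAddChar (Units.mk0 c hc)
    rw [legendreChar_isQuadratic.inv] at h
    exact h

/-- Each x has 1 + χ(x) square roots, and the constant 1 contributes a full character sum, which is
zero. -/
theorem sum_stdAddChar_mul_sq (ht : t ≠ 2) {b : ZMod t} (hb : b ≠ 0) :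
    ∑ v : ZMod t, ZMod.stdAddChar (b * v ^ 2) = legendreChar t b * quadGauss t := by
  classical
  have hsum : ∑ x : ZMod t, (ZMod.stdAddChar (b * x) : ℂ) = 0 := by
    have h := AddChar.sum_mulShift b (ZMod.isPrimitive_stdAddChar t)
    simpa [hb, mul_comm] using h
  rw [← sum_legendreChar_mul_stdAddChar ht,
    ← Finset.sum_fiberwise_of_maps_to (t := Finset.univ) (g := fun v : ZMod t ↦ v ^ 2)
      fun _ _ ↦ Finset.mem_univ _]
  have h (x : ZMod t) : ∑ v : ZMod t with v ^ 2 = x, (ZMod.stdAddChar (b * v ^ 2) : ℂ) =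
      legendreChar t x * ZMod.stdAddChar (b * x) + ZMod.stdAddChar (b * x) := by
    rw [Finset.sum_congr rfl (g := fun _ ↦ (ZMod.stdAddChar (b * x) : ℂ))
      fun v hv ↦ by rw [(Finset.mem_filter.mp hv).2], Finset.sum_const, nsmul_eq_mul]
    have hc := quadraticChar_card_sqrts (F := ZMod t) (by rwa [ZMod.ringChar_zmod_n]) x
    have hc' : ((Finset.univ.filter fun v : ZMod t ↦ v ^ 2 = x).card : ℤ) =
        quadraticChar (ZMod t) x + 1 := by
      rw [← hc]
      congr 2
      ext
      simp
    rw [legendreChar_apply, ← add_one_mul]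
    congr 1
    exact_mod_cast hc'
  rw [Finset.sum_congr rfl fun x _ ↦ h x, Finset.sum_add_distrib, hsum, add_zero]

/-- Quadratic Gauss sums with a linear term, by completing the square. -/
theorem sum_stdAddChar_quadratic (ht : t ≠ 2) {b c : ZMod t} (hbc : 4 * b * c = -1) (m : ZMod t) :
    ∑ v : ZMod t, ZMod.stdAddChar (b * v ^ 2 + m * v) =
      legendreChar t b * quadGauss t * ZMod.stdAddChar (c * m ^ 2) := by
  have hb : b ≠ 0 := by rintro rfl; simp at hbc
  rw [← sum_stdAddChar_mul_sq ht hb, Finset.sum_mul]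
  refine Fintype.sum_equiv (Equiv.subRight (2 * c * m)) _ _ fun v ↦ ?_
  rw [← AddChar.map_add_eq_mul, Equiv.subRight_apply]
  congr 1
  linear_combination (m * v - c * m ^ 2) * hbc

end GaussSum

/-! ### The transformation of `η((z + 24 a) / t)` -/

/-- The function `η((z + 24 a) / t)`, for `a` modulo `t`. -/
def etaShift (t : ℕ) [NeZero t] (a : ZMod t) (z : ℂ) : ℂ := ModularForm.eta ((z + 24 * a.val) / t)

variable {t : ℕ} [Fact t.Prime]

theorem im_shift_pos {z : ℂ} (hz : 0 < z.im) (n : ℤ) : 0 < ((z + 24 * n) / t).im := by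
  have ht : (0 : ℝ) < t := by exact_mod_cast (Fact.out : t.Prime).pos
  rw [show ((t : ℕ) : ℂ) = ((t : ℝ) : ℂ) by simp, Complex.div_ofReal_im]
  simpa using div_pos hz ht

/-- Since q^(n²/24) is evaluated at a shift by 24b/t, the factor 24 clears the denominator and the
new coefficient is a character of b n² modulo t. -/
theorem hasSum_two_mul_eta_shift {z : ℂ} (hz : 0 < z.im) (b : ℤ) :
    HasSum (fun n : ℤ ↦ (chi12 n : ℂ) * ZMod.stdAddChar ((b : ZMod t) * (n : ZMod t) ^ 2) *
        Complex.exp (π * Complex.I * (n : ℂ) ^ 2 * z / (12 * t : ℕ)))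
      (2 * ModularForm.eta ((z + 24 * b) / t)) := by
  have ht0 : (t : ℂ) ≠ 0 := by exact_mod_cast (Fact.out : t.Prime).ne_zero
  refine (hasSum_two_mul_eta (im_shift_pos hz b)).congr_fun fun n ↦ ?_
  rw [show (b : ZMod t) * (n : ZMod t) ^ 2 = ((b * n ^ 2 : ℤ) : ZMod t) by push_cast; rfl,
    ZMod.stdAddChar_coe, mul_assoc, ← Complex.exp_add]
  congr 2
  push_cast
  field_simp
  ring

theorem hasSum_two_mul_etaShift {z : ℂ} (hz : 0 < z.im) (a : ZMod t) :
    HasSum (fun n : ℤ ↦ (chi12 n : ℂ) * ZMod.stdAddChar (a * (n : ZMod t) ^ 2) *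
        Complex.exp (π * Complex.I * (n : ℂ) ^ 2 * z / (12 * t : ℕ)))
      (2 * etaShift t a z) := by
  simpa [etaShift] using hasSum_two_mul_eta_shift (t := t) hz a.val

/-- The summation over `ℤ/12tℤ` by the Chinese remainder theorem. -/
theorem sum_zmod_twelve_mul {M : Type*} [AddCommMonoid M] (ht : t.Coprime 12)
    (F : ZMod (12 * t) → M) :
    ∑ r, F r = ∑ u : ZMod 12, ∑ v : ZMod t, F ((t * u.val + 12 * v.val : ℤ) : ZMod (12 * t)) := by
  rw [← Fintype.sum_prod_type']
  symm
  refine Fintype.sum_bijective (fun p : ZMod 12 × ZMod t ↦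
    ((t * p.1.val + 12 * p.2.val : ℤ) : ZMod (12 * t))) ?_ _ _ fun _ ↦ rfl
  rw [Fintype.bijective_iff_injective_and_card]
  refine ⟨fun p q h ↦ ?_, by simp [ZMod.card]⟩
  have h12 := congrArg (ZMod.castHom (dvd_mul_right 12 t) (ZMod 12)) h
  have hdt := congrArg (ZMod.castHom (dvd_mul_left t 12) (ZMod t)) h
  have h0 : (12 : ZMod 12) = 0 := by decide
  simp only [map_intCast] at h12 hdt
  push_cast at h12 hdt
  simp only [ZMod.natCast_val, ZMod.cast_id', id, CharP.cast_eq_zero, zero_mul, zero_add, h0,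
    add_zero] at h12 hdt
  have hu : IsUnit (t : ZMod 12) := (ZMod.isUnit_iff_coprime t 12).mpr ht
  have hu' : IsUnit (12 : ZMod t) := by
    simpa using (ZMod.isUnit_iff_coprime 12 t).mpr ht.symm
  exact Prod.ext (hu.mul_left_cancel h12) (hu'.mul_left_cancel hdt)

/-- With r = tu + 12v the sum splits into the χ₁₂ sum over u and a quadratic Gauss sum over v with
leading coefficient 144a. Completing the square yields b, as 4·144·a·b = -1. -/
theorem fourier_chi12_mul_stdAddChar (ht : t.Coprime 12) {a b : ZMod t} (hab : 576 * a * b = -1)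
    (m : ℤ) :
    ∑ r : ZMod (12 * t), (chi12 r.val : ℂ) * ZMod.stdAddChar (a * (r.val : ZMod t) ^ 2) *
        ZMod.stdAddChar (r * (m : ZMod (12 * t))) =
      (√12 : ℝ) * chi12 t * legendreChar t a * quadGauss t *
        (chi12 m * ZMod.stdAddChar (b * (m : ZMod t) ^ 2)) := by
  have ht0 : (t : ℂ) ≠ 0 := by exact_mod_cast (Fact.out : t.Prime).ne_zero
  have ht2 : t ≠ 2 := by rintro rfl; revert ht; decide
  have ha : a ≠ 0 := by rintro rfl; simp at hab
  have h12 : (12 : ZMod t) ≠ 0 := fun h ↦ by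
    rw [show (576 : ZMod t) = 12 * 48 by norm_num, h] at hab
    simp at hab
  rw [sum_zmod_twelve_mul ht]
  have hval (n : ℤ) : ((n : ZMod (12 * t)).val : ℤ) ≡ n [ZMOD (12 * t : ℕ)] := by
    rw [← ZMod.intCast_eq_intCast_iff]
    simp
  have hterm (u : ZMod 12) (v : ZMod t) :
      (chi12 ((t * u.val + 12 * v.val : ℤ) : ZMod (12 * t)).val : ℂ) *
        ZMod.stdAddChar (a * (((t * u.val + 12 * v.val : ℤ) : ZMod (12 * t)).val : ZMod t) ^ 2) *
        ZMod.stdAddChar (((t * u.val + 12 * v.val : ℤ) : ZMod (12 * t)) * (m : ZMod (12 * t))) =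
      chi12 t * (chi12Mod u * ZMod.stdAddChar (u * (m : ZMod 12))) *
        ZMod.stdAddChar (144 * a * v ^ 2 + (m : ZMod t) * v) := by
    have h1 : chi12 ((t * u.val + 12 * v.val : ℤ) : ZMod (12 * t)).val = chi12 t * chi12Mod u := by
      rw [chi12_congr ((hval _).of_dvd (by push_cast; exact dvd_mul_right _ _)),
        chi12_congr (b := t * u.val) (by simp [Int.modEq_iff_dvd]), chi12_mul,
        chi12_eq_chi12Mod u.val]
      simp
    have h2 : (((t * u.val + 12 * v.val : ℤ) : ZMod (12 * t)).val : ZMod t) = 12 * v := by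
      have := (ZMod.intCast_eq_intCast_iff _ _ t).mpr
        ((hval (t * u.val + 12 * v.val)).of_dvd (by push_cast; exact dvd_mul_left _ _))
      push_cast at this ⊢
      simpa using this
    have h3 : (ZMod.stdAddChar
        (((t * u.val + 12 * v.val : ℤ) : ZMod (12 * t)) * (m : ZMod (12 * t))) : ℂ) =
        ZMod.stdAddChar (u * (m : ZMod 12)) * ZMod.stdAddChar ((m : ZMod t) * v) := by
      rw [← Int.cast_mul, ZMod.stdAddChar_coe,
        show u * (m : ZMod 12) = ((u.val * m : ℤ) : ZMod 12) by simp,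
        show (m : ZMod t) * v = ((m * v.val : ℤ) : ZMod t) by simp,
        ZMod.stdAddChar_coe, ZMod.stdAddChar_coe, ← Complex.exp_add]
      congr 1
      push_cast
      field_simp
    rw [h1, h2, h3, AddChar.map_add_eq_mul]
    push_cast
    ring_nf
  simp only [hterm, ← Finset.mul_sum, ← Finset.sum_mul]
  rw [sum_chi12Mod_mul_stdAddChar,
    sum_stdAddChar_quadratic ht2 (c := b) (by linear_combination hab), ← chi12_eq_chi12Mod,
    show (144 : ZMod t) = 12 * 12 by norm_num, map_mul, map_mul, legendreChar_mul_self h12]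
  ring

/-- The transformation of `η((z + 24 a) / t)` under `z ↦ -1/z`, for `a` prime to `t`. -/
theorem etaShift_neg_inv (ht : t.Coprime 12) {a b : ZMod t} (hab : 576 * a * b = -1) {z : ℂ}
    (hz : 0 < z.im) :
    quadGauss t * etaShift t b (-1 / z) =
      (√t : ℝ) * chi12 t * legendreChar t a * (-Complex.I * z) ^ (1 / 2 : ℂ) * etaShift t a z := by
  have htp : (0 : ℝ) < t := by exact_mod_cast (Fact.out : t.Prime).pos
  have ha : a ≠ 0 := by rintro rfl; simp at hab
  have hz0 : z ≠ 0 := by rintro rfl; simp at hz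
  have him : 0 < (-1 / z).im := by
    simpa [neg_div] using UpperHalfPlane.im_inv_neg_coe_pos ⟨z, hz⟩
  have hJ : (-Complex.I * z) ^ (1 / 2 : ℂ) ≠ 0 := by simp [Complex.cpow_eq_zero_iff, hz0]
  have h12 : ((√12 : ℝ) : ℂ) ≠ 0 := by
    exact_mod_cast (Real.sqrt_pos.mpr (by norm_num : (0 : ℝ) < 12)).ne'
  have hst : ((√t : ℝ) : ℂ) ≠ 0 := by exact_mod_cast (Real.sqrt_pos.mpr htp).ne'
  have h := hasSum_theta_transform (12 * t)
    (fun r ↦ (chi12 r.val : ℂ) * ZMod.stdAddChar (a * (r.val : ZMod t) ^ 2)) hz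
    (((hasSum_two_mul_etaShift him b).mul_left
      ((√12 : ℝ) * chi12 t * legendreChar t a * quadGauss t : ℂ)).congr_fun fun n ↦ by
      rw [fourier_chi12_mul_stdAddChar ht hab]
      ring)
  have hval (n : ℤ) : ((n : ZMod (12 * t)).val : ℤ) ≡ n [ZMOD (12 * t : ℕ)] := by
    rw [← ZMod.intCast_eq_intCast_iff]
    simp
  have h' := h.unique ((hasSum_two_mul_etaShift hz a).congr_fun fun n ↦ by
    have h2 := (ZMod.intCast_eq_intCast_iff _ _ t).mpr
      ((hval n).of_dvd (by push_cast; exact dvd_mul_left _ _))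
    rw [chi12_congr ((hval n).of_dvd (by push_cast; exact dvd_mul_right _ _)), ← h2]
    simp)
  have hcs := neg_I_mul_ofReal_mul_cpow (by positivity : (0 : ℝ) < 12 * t) hz0
  rw [Nat.cast_mul, Nat.cast_ofNat, show (12 * t : ℂ) = ((12 * t : ℝ) : ℂ) by push_cast; rfl, hcs,
    Real.sqrt_mul (by norm_num)] at h'
  have hχ := legendreChar_mul_self ha
  have hc : (chi12 t : ℂ) ^ 2 = 1 := by exact_mod_cast chi12_sq ht
  push_cast at h'
  field_simp at h'
  rw [neg_div, neg_mul]
  linear_combination (chi12 t : ℂ) * legendreChar t a * h' -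
    quadGauss t * etaShift t b (-(1 / z)) * legendreChar t a ^ 2 * hc -
    quadGauss t * etaShift t b (-(1 / z)) * hχ

/-! ### Functions that are meromorphic at `i∞` -/

namespace IsMeromorphicAtImInfty

variable {f g : ℍ → ℂ}

theorem of_eventuallyEq {h : ℕ} (hh : 0 < h) {F : ℂ → ℂ} (hF : MeromorphicAt F 0)
    (hf : ∀ᶠ z in UpperHalfPlane.atImInfty, f z = F (Function.Periodic.qParam h (z : ℂ))) :
    IsMeromorphicAtImInfty f := ⟨h, hh, F, hF, hf⟩

/-- As q_h = q_{hk}^k, the width may be enlarged, which lets two functions share one local variable.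
-/
theorem exists_mul_period {h : ℕ} (hh : 0 < h) {F : ℂ → ℂ} (hF : MeromorphicAt F 0)
    (hf : ∀ᶠ z in UpperHalfPlane.atImInfty, f z = F (Function.Periodic.qParam h (z : ℂ)))
    {k : ℕ} (hk : 0 < k) :
    ∃ F' : ℂ → ℂ, MeromorphicAt F' 0 ∧
      ∀ᶠ z in UpperHalfPlane.atImInfty,
        f z = F' (Function.Periodic.qParam (h * k : ℕ) (z : ℂ)) := by
  refine ⟨fun x ↦ F (x ^ k), MeromorphicAt.comp_analyticAt (g := fun x : ℂ ↦ x ^ k)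
    (by simpa [hk.ne'] using hF) (by fun_prop), hf.mono fun z hz ↦ ?_⟩
  rw [hz]
  have hk' : (k : ℂ) ≠ 0 := by exact_mod_cast hk.ne'
  have hh' : (h : ℂ) ≠ 0 := by exact_mod_cast hh.ne'
  congr 1
  rw [Function.Periodic.qParam, Function.Periodic.qParam, ← Complex.exp_nat_mul]
  congr 1
  push_cast
  field_simp

theorem exists_common (hf : IsMeromorphicAtImInfty f) (hg : IsMeromorphicAtImInfty g) :
    ∃ h : ℕ, 0 < h ∧ ∃ F G : ℂ → ℂ, MeromorphicAt F 0 ∧ MeromorphicAt G 0 ∧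
      (∀ᶠ z in UpperHalfPlane.atImInfty, f z = F (Function.Periodic.qParam h (z : ℂ))) ∧
      ∀ᶠ z in UpperHalfPlane.atImInfty, g z = G (Function.Periodic.qParam h (z : ℂ)) := by
  obtain ⟨h, hh, F, hF, hfF⟩ := hf
  obtain ⟨k, hk, G, hG, hgG⟩ := hg
  obtain ⟨F', hF', hfF'⟩ := exists_mul_period hh hF hfF hk
  obtain ⟨G', hG', hgG'⟩ := exists_mul_period hk hG hgG hh
  exact ⟨h * k, Nat.mul_pos hh hk, F', G', hF', hG', hfF', mul_comm k h ▸ hgG'⟩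

theorem mul (hf : IsMeromorphicAtImInfty f) (hg : IsMeromorphicAtImInfty g) :
    IsMeromorphicAtImInfty fun z ↦ f z * g z := by
  obtain ⟨h, hh, F, G, hF, hG, h1, h2⟩ := hf.exists_common hg
  exact of_eventuallyEq hh (hF.mul hG) (by filter_upwards [h1, h2] with z h1 h2; simp [h1, h2])

theorem add (hf : IsMeromorphicAtImInfty f) (hg : IsMeromorphicAtImInfty g) :
    IsMeromorphicAtImInfty fun z ↦ f z + g z := by
  obtain ⟨h, hh, F, G, hF, hG, h1, h2⟩ := hf.exists_common hg
  exact of_eventuallyEq hh (hF.add hG) (by filter_upwards [h1, h2] with z h1 h2; simp [h1, h2])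

theorem inv (hf : IsMeromorphicAtImInfty f) : IsMeromorphicAtImInfty fun z ↦ (f z)⁻¹ := by
  obtain ⟨h, hh, F, hF, h1⟩ := hf
  exact of_eventuallyEq hh hF.inv (by filter_upwards [h1] with z h1; simp [h1])

theorem const (c : ℂ) : IsMeromorphicAtImInfty fun _ ↦ c :=
  of_eventuallyEq one_pos (MeromorphicAt.const c 0) (.of_forall fun _ ↦ rfl)

theorem const_mul (c : ℂ) (hf : IsMeromorphicAtImInfty f) :
    IsMeromorphicAtImInfty fun z ↦ c * f z := (const c).mul hf

theorem div (hf : IsMeromorphicAtImInfty f) (hg : IsMeromorphicAtImInfty g) :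
    IsMeromorphicAtImInfty fun z ↦ f z / g z := by
  simpa only [div_eq_mul_inv] using hf.mul hg.inv

theorem sub (hf : IsMeromorphicAtImInfty f) (hg : IsMeromorphicAtImInfty g) :
    IsMeromorphicAtImInfty fun z ↦ f z - g z := by
  simpa [sub_eq_add_neg] using hf.add (hg.const_mul (-1))

theorem sum {ι : Type*} (s : Finset ι) {f : ι → ℍ → ℂ}
    (hf : ∀ i ∈ s, IsMeromorphicAtImInfty (f i)) :
    IsMeromorphicAtImInfty fun z ↦ ∑ i ∈ s, f i z := by
  classical
  induction s using Finset.induction_on with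
  | empty => simpa using const 0
  | insert i s hi ih =>
    simp only [Finset.sum_insert hi]
    exact (hf i (by simp)).add (ih fun j hj ↦ hf j (by simp [hj]))

/-- Meromorphy at `i∞` is preserved under `z ↦ (a z + b) / d`. -/
theorem comp_affine (hf : IsMeromorphicAtImInfty f) {a d : ℕ} (ha : 0 < a) (hd : 0 < d) (b : ℤ)
    {φ : ℍ → ℍ} (hφ : ∀ z : ℍ, (φ z : ℂ) = (a * z + b) / d) :
    IsMeromorphicAtImInfty fun z ↦ f (φ z) := by
  obtain ⟨h, hh, F, hF, h1⟩ := hf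
  have hd' : (d : ℂ) ≠ 0 := by exact_mod_cast hd.ne'
  have hh' : (h : ℂ) ≠ 0 := by exact_mod_cast hh.ne'
  have him (z : ℍ) : (φ z).im = a / d * z.im := by
    rw [← UpperHalfPlane.coe_im, hφ, show (d : ℂ) = ((d : ℝ) : ℂ) by simp, Complex.div_ofReal_im]
    simp
    ring
  have htend : Tendsto φ UpperHalfPlane.atImInfty UpperHalfPlane.atImInfty := by
    refine tendsto_comap_iff.mpr ?_
    have : Tendsto (fun z : ℍ ↦ (a / d : ℝ) * z.im) UpperHalfPlane.atImInfty atTop :=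
      tendsto_comap.const_mul_atTop (by positivity)
    exact this.congr fun z ↦ (him z).symm
  -- The local variable q_h at (az + b)/d is exp(2πib/(dh)) times the a-th power of q_{dh} at z.
  refine of_eventuallyEq (Nat.mul_pos hd hh)
    (F := fun x ↦ F (Complex.exp (2 * π * Complex.I * b / (d * h)) * x ^ a))
    (MeromorphicAt.comp_analyticAt
      (g := fun x : ℂ ↦ Complex.exp (2 * π * Complex.I * b / (d * h)) * x ^ a)
      (by simpa [ha.ne'] using hF) (by fun_prop)) ?_
  filter_upwards [htend.eventually h1] with z hz
  rw [hz]
  congr 1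
  rw [Function.Periodic.qParam, Function.Periodic.qParam, ← Complex.exp_nat_mul, ← Complex.exp_add,
    hφ]
  congr 1
  push_cast
  field_simp
  ring

theorem qParam (h : ℕ) (hh : 0 < h) :
    IsMeromorphicAtImInfty fun z ↦ Function.Periodic.qParam h (z : ℂ) :=
  of_eventuallyEq hh (MeromorphicAt.id 0) (.of_forall fun _ ↦ rfl)

end IsMeromorphicAtImInfty

/-! ### Holomorphy of pullbacks, and η at `i∞`. -/

theorem mdifferentiable_comp_affine {f : ℍ → ℂ} (hf : MDifferentiable 𝓘(ℂ) 𝓘(ℂ) f)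
    {a b : ℂ} {φ : ℍ → ℍ} (hφ : ∀ z : ℍ, (φ z : ℂ) = a * z + b) :
    MDifferentiable 𝓘(ℂ) 𝓘(ℂ) fun z ↦ f (φ z) := by
  rw [UpperHalfPlane.mdifferentiable_iff] at hf ⊢
  have hmaps : Set.MapsTo (fun z : ℂ ↦ a * z + b) UpperHalfPlane.upperHalfPlaneSet
      UpperHalfPlane.upperHalfPlaneSet := fun z hz ↦ by
    have := (φ ⟨z, hz⟩).im_pos
    rwa [← UpperHalfPlane.coe_im, hφ] at this
  refine (hf.comp (g := f ∘ UpperHalfPlane.ofComplex) (f := fun z : ℂ ↦ a * z + b)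
    (by fun_prop) hmaps).congr fun z hz ↦ ?_
  simp only [Function.comp_apply]
  congr 1
  rw [UpperHalfPlane.ofComplex_apply_of_im_pos hz]
  ext
  rw [hφ, UpperHalfPlane.ofComplex_apply_of_im_pos (hmaps hz)]

/-- A holomorphic function of period `1` that is bounded at `i∞` is meromorphic there. -/
theorem isMeromorphicAtImInfty_of_isBoundedAtImInfty {f : ℍ → ℂ}
    (hf : MDifferentiable 𝓘(ℂ) 𝓘(ℂ) f)
    (hper : Function.Periodic (f ∘ UpperHalfPlane.ofComplex) (1 : ℝ))
    (hbdd : UpperHalfPlane.IsBoundedAtImInfty f) : IsMeromorphicAtImInfty f :=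
  .of_eventuallyEq one_pos
    (UpperHalfPlane.analyticAt_cuspFunction_zero one_pos hper hf hbdd).meromorphicAt
    (.of_forall fun z ↦ by
      simpa using (UpperHalfPlane.eq_cuspFunction z one_ne_zero hper).symm)

theorem isMeromorphicAtImInfty_eta : IsMeromorphicAtImInfty fun z ↦ ModularForm.eta z := by
  have hP : AnalyticAt ℂ (fun q : ℂ ↦ ∏' n : ℕ, (1 - q ^ (n + 1))) 0 :=
    ModularForm.differentiableOn_tprod_one_sub_pow.analyticAt
      (Metric.ball_mem_nhds 0 one_pos)
  have hP' : AnalyticAt ℂ (fun x : ℂ ↦ ∏' n : ℕ, (1 - (x ^ 24) ^ (n + 1))) 0 :=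
    AnalyticAt.comp (g := fun q : ℂ ↦ ∏' n : ℕ, (1 - q ^ (n + 1))) (f := fun x : ℂ ↦ x ^ 24)
      (x := 0) (by simpa using hP) (by fun_prop)
  refine .of_eventuallyEq (h := 24) (by norm_num) (analyticAt_id.mul hP').meromorphicAt
    (.of_forall fun z ↦ ?_)
  have hq : Function.Periodic.qParam 24 (z : ℂ) ^ 24 = Function.Periodic.qParam 1 (z : ℂ) := by
    rw [Function.Periodic.qParam, Function.Periodic.qParam, ← Complex.exp_nat_mul]
    congr 1
    push_cast
    ring
  simp only [Nat.cast_ofNat, Pi.mul_apply, id, hq]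
  rfl

theorem mdifferentiable_eta : MDifferentiable 𝓘(ℂ) 𝓘(ℂ) fun z : ℍ ↦ ModularForm.eta z := by
  rw [UpperHalfPlane.mdifferentiable_iff]
  refine DifferentiableOn.congr (f := ModularForm.eta) (fun z hz ↦
    (ModularForm.differentiableAt_eta_of_mem_upperHalfPlaneSet hz).differentiableWithinAt)
    fun z hz ↦ ?_
  simp [UpperHalfPlane.ofComplex_apply_of_im_pos hz]

theorem mdifferentiable_div {f g : ℍ → ℂ} (hf : MDifferentiable 𝓘(ℂ) 𝓘(ℂ) f)
    (hg : MDifferentiable 𝓘(ℂ) 𝓘(ℂ) g) (h0 : ∀ z, g z ≠ 0) :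
    MDifferentiable 𝓘(ℂ) 𝓘(ℂ) fun z ↦ f z / g z := by
  rw [UpperHalfPlane.mdifferentiable_iff] at hf hg ⊢
  exact hf.div hg fun z _ ↦ h0 _

theorem mdifferentiable_finset_sum {ι : Type*} (s : Finset ι) {f : ι → ℍ → ℂ}
    (hf : ∀ i ∈ s, MDifferentiable 𝓘(ℂ) 𝓘(ℂ) (f i)) :
    MDifferentiable 𝓘(ℂ) 𝓘(ℂ) fun z ↦ ∑ i ∈ s, f i z := by
  simp only [UpperHalfPlane.mdifferentiable_iff] at hf ⊢
  exact DifferentiableOn.fun_sum hf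

/-! ### The Eisenstein series of weight `2` on `Γ₀(t)` -/

@[simp]
theorem coe_scale (n : ℕ) [NeZero n] (z : ℍ) : (scale n z : ℂ) = n * z := by
  simp [scale]

theorem smul_apply_of_slash_eq {f g : ℍ → ℂ} {k : ℤ} {γ : SL(2, ℤ)} (h : f ∣[k] γ = g) (z : ℍ) :
    f (γ • z) = ((γ 1 0 : ℂ) * z + γ 1 1) ^ k * g z := by
  have hd : ((γ 1 0 : ℂ) * z + γ 1 1) ≠ 0 := by
    simpa [UpperHalfPlane.denom] using UpperHalfPlane.denom_ne_zero γ z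
  rw [← h, ModularForm.SL_slash_apply]
  simp only [UpperHalfPlane.denom]
  rw [zpow_neg]
  simp
  field_simp

theorem slash_eq_of_smul_apply {f g : ℍ → ℂ} {k : ℤ} {γ : SL(2, ℤ)}
    (h : ∀ z : ℍ, f (γ • z) = ((γ 1 0 : ℂ) * z + γ 1 1) ^ k * g z) : f ∣[k] γ = g := by
  ext z
  have hd : ((γ 1 0 : ℂ) * z + γ 1 1) ≠ 0 := by
    simpa [UpperHalfPlane.denom] using UpperHalfPlane.denom_ne_zero γ z
  rw [ModularForm.SL_slash_apply, h, zpow_neg]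
  simp [UpperHalfPlane.denom]
  field_simp

theorem coe_S_smul (z : ℍ) : ((ModularGroup.S • z : ℍ) : ℂ) = -1 / z := by
  rw [UpperHalfPlane.modular_S_smul]
  simp [neg_div]

theorem coe_T_smul (z : ℍ) : ((ModularGroup.T • z : ℍ) : ℂ) = z + 1 := by
  rw [UpperHalfPlane.modular_T_smul]
  simp [add_comm]

theorem S_smul_apply_of_slash_eq {f g : ℍ → ℂ} {k : ℤ} (h : f ∣[k] ModularGroup.S = g) (z : ℍ) :
    f (ModularGroup.S • z) = (z : ℂ) ^ k * g z := by
  simpa [ModularGroup.S] using smul_apply_of_slash_eq h z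

theorem E2_smul (γ : SL(2, ℤ)) (z : ℍ) :
    EisensteinSeries.E2 (γ • z) = ((γ 1 0 : ℂ) * z + γ 1 1) ^ 2 * EisensteinSeries.E2 z -
      1 / (2 * riemannZeta 2) * (2 * π * Complex.I) * γ 1 0 * ((γ 1 0 : ℂ) * z + γ 1 1) := by
  have hd : ((γ 1 0 : ℂ) * z + γ 1 1) ≠ 0 := by
    simpa [UpperHalfPlane.denom] using UpperHalfPlane.denom_ne_zero γ z
  have h := smul_apply_of_slash_eq (EisensteinSeries.E2_slash_action γ) z
  rw [h]
  simp [EisensteinSeries.D2, UpperHalfPlane.denom]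
  field_simp

theorem periodic_of_smul_T {f : ℍ → ℂ} (h : ∀ z, f (ModularGroup.T • z) = f z) :
    Function.Periodic (f ∘ UpperHalfPlane.ofComplex) (1 : ℝ) := by
  intro w
  by_cases hw : 0 < w.im
  · have hw' : 0 < (w + (1 : ℝ)).im := by simpa using hw
    simp only [Function.comp_apply]
    rw [UpperHalfPlane.ofComplex_apply_of_im_pos hw, UpperHalfPlane.ofComplex_apply_of_im_pos hw',
      ← h ⟨w, hw⟩]
    congr 1
    ext
    rw [coe_T_smul]
    simp
  -- Off the upper half plane `ofComplex` takes a constant default value.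
  · have hw' : ¬ 0 < (w + (1 : ℝ)).im := by simpa using hw
    simp only [Function.comp_apply]
    rw [UpperHalfPlane.ofComplex_apply_of_im_nonpos (not_lt.mp hw),
      UpperHalfPlane.ofComplex_apply_of_im_nonpos (not_lt.mp hw')]

theorem isMeromorphicAtImInfty_E2 : IsMeromorphicAtImInfty EisensteinSeries.E2 := by
  refine isMeromorphicAtImInfty_of_isBoundedAtImInfty E2_mdifferentiable
    (periodic_of_smul_T fun z ↦ ?_) EisensteinSeries.isBoundedAtImInfty_E2
  rw [E2_smul]
  simp [ModularGroup.T]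

/-- The point `(z + b) / n`. -/
def shift (n : ℕ) [NeZero n] (b : ℤ) (z : ℍ) : ℍ :=
  ⟨(z + b) / n, by
    have hn : (0 : ℝ) < n := by exact_mod_cast NeZero.pos n
    rw [show ((n : ℕ) : ℂ) = ((n : ℝ) : ℂ) by simp, Complex.div_ofReal_im]
    simpa using div_pos z.im_pos hn⟩

@[simp]
theorem coe_shift (n : ℕ) [NeZero n] (b : ℤ) (z : ℍ) : (shift n b z : ℂ) = (z + b) / n := rfl

theorem IsMeromorphicAtImInfty.comp_scale {f : ℍ → ℂ} (hf : IsMeromorphicAtImInfty f) (n : ℕ)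
    [NeZero n] : IsMeromorphicAtImInfty fun z ↦ f (scale n z) :=
  hf.comp_affine (a := n) (d := 1) (NeZero.pos n) one_pos 0 (by simp)

theorem IsMeromorphicAtImInfty.comp_shift {f : ℍ → ℂ} (hf : IsMeromorphicAtImInfty f) (n : ℕ)
    [NeZero n] (b : ℤ) : IsMeromorphicAtImInfty fun z ↦ f (shift n b z) :=
  hf.comp_affine (a := 1) (d := n) one_pos (NeZero.pos n) b (by simp)

theorem mdifferentiable_comp_scale {f : ℍ → ℂ} (hf : MDifferentiable 𝓘(ℂ) 𝓘(ℂ) f) (n : ℕ)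
    [NeZero n] : MDifferentiable 𝓘(ℂ) 𝓘(ℂ) fun z ↦ f (scale n z) :=
  mdifferentiable_comp_affine hf (a := n) (b := 0) (by simp)

theorem mdifferentiable_comp_shift {f : ℍ → ℂ} (hf : MDifferentiable 𝓘(ℂ) 𝓘(ℂ) f) (n : ℕ)
    [NeZero n] (b : ℤ) : MDifferentiable 𝓘(ℂ) 𝓘(ℂ) fun z ↦ f (shift n b z) :=
  mdifferentiable_comp_affine hf (a := 1 / n) (b := b / n) fun z ↦ by
    rw [coe_shift]
    ring

section Eisenstein

variable {t : ℕ} [NeZero t]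

theorem mdifferentiable_eisensteinTwo : MDifferentiable 𝓘(ℂ) 𝓘(ℂ) (eisensteinTwo t) := by
  have h := E2_mdifferentiable
  have h' := mdifferentiable_comp_scale h t
  rw [UpperHalfPlane.mdifferentiable_iff] at h h' ⊢
  exact ((h'.const_mul (t : ℂ)).sub h).const_mul (1 / ((t : ℂ) - 1))

theorem isMeromorphicAtImInfty_eisensteinTwo : IsMeromorphicAtImInfty (eisensteinTwo t) :=
  (((isMeromorphicAtImInfty_E2.comp_scale t).const_mul t).sub
    isMeromorphicAtImInfty_E2).const_mul _

/-- For `γ = (a b; n c d)`, the matrix `(a n b; c d)`, which satisfies `n (γ z) = γ' (n z)`. -/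
theorem exists_conj_of_dvd (γ : SL(2, ℤ)) (h : (t : ℤ) ∣ γ 1 0) :
    ∃ δ : SL(2, ℤ), δ 0 0 = γ 0 0 ∧ δ 0 1 = t * γ 0 1 ∧ t * δ 1 0 = γ 1 0 ∧ δ 1 1 = γ 1 1 ∧
      ∀ z : ℍ, scale t (γ • z) = δ • scale t z := by
  obtain ⟨c, hc⟩ := h
  have hdet := γ.det_coe
  rw [Matrix.det_fin_two] at hdet
  let δ : SL(2, ℤ) := ⟨!![γ 0 0, t * γ 0 1; c, γ 1 1], by
    rw [Matrix.det_fin_two_of]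
    linear_combination hdet + γ 0 1 * hc⟩
  have h00 : δ 0 0 = γ 0 0 := rfl
  have h01 : δ 0 1 = t * γ 0 1 := rfl
  have h10 : δ 1 0 = c := rfl
  have h11 : δ 1 1 = γ 1 1 := rfl
  refine ⟨δ, h00, h01, by rw [h10, hc], h11, fun z ↦ ?_⟩
  ext
  have hc' : (γ 1 0 : ℂ) = t * c := by exact_mod_cast hc
  rw [coe_scale, UpperHalfPlane.coe_specialLinearGroup_apply,
    UpperHalfPlane.coe_specialLinearGroup_apply, coe_scale, h00, h01, h10, h11]
  simp only [algebraMap_int_eq, eq_intCast, Complex.ofReal_intCast, hc']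
  push_cast
  ring

/-- The failure of modularity of E₂ is proportional to c(cz + d). For t E₂(tz) it is t·(c/t)·(cz +
d), so the two defects cancel. -/
theorem eisensteinTwo_slash {γ : SL(2, ℤ)} (hγ : γ ∈ CongruenceSubgroup.Gamma0 t) :
    eisensteinTwo t ∣[(2 : ℤ)] γ = eisensteinTwo t := by
  have hdvd : (t : ℤ) ∣ γ 1 0 := by
    rwa [CongruenceSubgroup.Gamma0_mem, ZMod.intCast_zmod_eq_zero_iff_dvd] at hγ
  obtain ⟨δ, -, -, h10, h11, hδ⟩ := exists_conj_of_dvd γ hdvd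
  refine slash_eq_of_smul_apply fun z ↦ ?_
  have hc' : (γ 1 0 : ℂ) = t * δ 1 0 := by exact_mod_cast h10.symm
  rw [eisensteinTwo, eisensteinTwo, hδ, E2_smul, E2_smul, h11, coe_scale, hc', zpow_ofNat]
  ring

theorem scale_S_smul (z : ℍ) : scale t (ModularGroup.S • z) = ModularGroup.S • shift t 0 z := by
  ext
  rw [coe_scale, coe_S_smul, coe_S_smul, coe_shift, Int.cast_zero, add_zero, div_div_eq_mul_div]
  ring

theorem shift_zero_S_smul (z : ℍ) :
    shift t 0 (ModularGroup.S • z) = ModularGroup.S • scale t z := by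
  ext
  rw [coe_shift, coe_S_smul, coe_S_smul, coe_scale, Int.cast_zero, add_zero, div_div,
    mul_comm]

/-- This describes the cusp 0. The defects of E₂ cancel again, since t·(z/t) = z. -/
theorem eisensteinTwo_slash_S : eisensteinTwo t ∣[(2 : ℤ)] ModularGroup.S = fun z ↦
    1 / ((t : ℂ) - 1) * (1 / t * EisensteinSeries.E2 (shift t 0 z) - EisensteinSeries.E2 z) := by
  refine slash_eq_of_smul_apply fun z ↦ ?_
  have ht : (t : ℂ) ≠ 0 := NeZero.ne _
  have h10 : ModularGroup.S 1 0 = 1 := rfl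
  have h11 : ModularGroup.S 1 1 = 0 := rfl
  rw [eisensteinTwo, scale_S_smul, E2_smul, E2_smul, h10, h11, zpow_ofNat]
  simp only [Int.cast_one, Int.cast_zero, coe_shift, add_zero, one_mul, mul_one]
  field_simp
  ring

theorem isMeromorphicAtImInfty_eisensteinTwo_slash_S :
    IsMeromorphicAtImInfty (eisensteinTwo t ∣[(2 : ℤ)] ModularGroup.S) := by
  rw [eisensteinTwo_slash_S]
  exact (((isMeromorphicAtImInfty_E2.comp_shift t 0).const_mul _).sub
    isMeromorphicAtImInfty_E2).const_mul _

end Eisenstein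

/-! ### The right action of `SL(2, ℤ)` on row vectors modulo `t` -/

/-- The row vector `v γ`, reduced modulo `t`. -/
def rowAct {t : ℕ} (γ : SL(2, ℤ)) (v : Fin 2 → ZMod t) : Fin 2 → ZMod t :=
  Matrix.vecMul v ((γ : Matrix (Fin 2) (Fin 2) ℤ).map (Int.castRingHom (ZMod t)))

section rowAct

variable {t : ℕ}

theorem rowAct_zero_apply (γ : SL(2, ℤ)) (v : Fin 2 → ZMod t) :
    rowAct γ v 0 = v 0 * (γ 0 0 : ℤ) + v 1 * (γ 1 0 : ℤ) := by
  simp [rowAct, Matrix.vecMul, dotProduct, Fin.sum_univ_two]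

theorem rowAct_one_apply (γ : SL(2, ℤ)) (v : Fin 2 → ZMod t) :
    rowAct γ v 1 = v 0 * (γ 0 1 : ℤ) + v 1 * (γ 1 1 : ℤ) := by
  simp [rowAct, Matrix.vecMul, dotProduct, Fin.sum_univ_two]

theorem rowAct_mul (γ δ : SL(2, ℤ)) (v : Fin 2 → ZMod t) :
    rowAct (γ * δ) v = rowAct δ (rowAct γ v) := by
  rw [rowAct, Matrix.SpecialLinearGroup.coe_mul, Matrix.map_mul, ← Matrix.vecMul_vecMul]
  rfl

theorem rowAct_one (v : Fin 2 → ZMod t) : rowAct 1 v = v := by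
  rw [rowAct, Matrix.SpecialLinearGroup.coe_one, Matrix.map_one _ (map_zero _) (map_one _),
    Matrix.vecMul_one]

theorem rowAct_bijective (γ : SL(2, ℤ)) :
    Function.Bijective (rowAct γ : (Fin 2 → ZMod t) → Fin 2 → ZMod t) := by
  refine Function.bijective_iff_has_inverse.mpr ⟨rowAct γ⁻¹, fun v ↦ ?_, fun v ↦ ?_⟩ <;>
    simp [← rowAct_mul, rowAct_one]

theorem rowAct_ne_zero (γ : SL(2, ℤ)) {v : Fin 2 → ZMod t} (hv : v ≠ 0) : rowAct γ v ≠ 0 := by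
  have h0 : rowAct γ (0 : Fin 2 → ZMod t) = 0 := by simp [rowAct]
  exact fun h ↦ hv ((rowAct_bijective γ).injective (h.trans h0.symm))

end rowAct

/-! ### The translates of a weight `2` form under matrices of determinant `t` -/

theorem SL2Z_induction {P : SL(2, ℤ) → Prop} (hone : P 1) (hS : P ModularGroup.S)
    (hT : P ModularGroup.T) (hmul : ∀ γ δ, P γ → P δ → P (γ * δ)) (hinv : ∀ γ, P γ → P γ⁻¹)
    (γ : SL(2, ℤ)) : P γ := by
  have hγ : γ ∈ Subgroup.closure {ModularGroup.S, ModularGroup.T} := by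
    simp [SpecialLinearGroup.SL2Z_generators]
  induction hγ using Subgroup.closure_induction with
  | one => exact hone
  | mem g hg => rcases hg with rfl | rfl <;> assumption
  | mul g h _ _ ig ih => exact hmul g h ig ih
  | inv g _ ig => exact hinv g ig

/-- The translates `G((z + 24 a) / t)` and `z⁻² G(-1 / (t z))` of a weight `2` form `G` on `Γ₀(t)`,
indexed by the row vectors `(u, v)` modulo `t`, with `24 a u = v`. -/
def formShift (t : ℕ) [Fact t.Prime] (G : ℍ → ℂ) (v : Fin 2 → ZMod t) (z : ℍ) : ℂ :=
  if v 0 = 0 then t ^ 2 * (G ∣[(2 : ℤ)] ModularGroup.S) (scale t z)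
  else G (shift t (24 * (v 1 / (24 * v 0)).val) z)

section formShift

variable {t : ℕ} [Fact t.Prime] {G : ℍ → ℂ}

theorem T_mem_Gamma0 (N : ℕ) : ModularGroup.T ∈ CongruenceSubgroup.Gamma0 N := by
  simp [CongruenceSubgroup.Gamma0_mem, ModularGroup.coe_T]

theorem apply_eq_of_coe_eq_add_one {k : ℤ} {f : ℍ → ℂ} (hf : f ∣[k] ModularGroup.T = f) {z w : ℍ}
    (h : (w : ℂ) = z + 1) : f w = f z := by
  have hw : w = ModularGroup.T • z := by
    ext
    rw [h, coe_T_smul]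
  rw [hw, smul_apply_of_slash_eq hf z]
  simp [ModularGroup.T]

theorem apply_eq_of_coe_eq_add_natCast {k : ℤ} {f : ℍ → ℂ} (hf : f ∣[k] ModularGroup.T = f) (n : ℕ)
    {z w : ℍ} (h : (w : ℂ) = z + n) : f w = f z := by
  induction n generalizing w with
  | zero => exact congrArg f (UpperHalfPlane.ext (by simpa using h))
  | succ n ih =>
    have him : 0 < ((z : ℂ) + n).im := by simpa using z.im_pos
    rw [← ih (w := ⟨z + n, him⟩) rfl]
    exact apply_eq_of_coe_eq_add_one hf (by rw [h]; push_cast; ring)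

theorem apply_eq_of_coe_eq_add_intCast {k : ℤ} {f : ℍ → ℂ} (hf : f ∣[k] ModularGroup.T = f) (n : ℤ)
    {z w : ℍ} (h : (w : ℂ) = z + n) : f w = f z := by
  obtain ⟨m, rfl | rfl⟩ := n.eq_nat_or_neg
  · exact apply_eq_of_coe_eq_add_natCast hf m (by simpa using h)
  · exact (apply_eq_of_coe_eq_add_natCast hf m (by rw [h]; push_cast; ring)).symm

theorem apply_shift_congr {k : ℤ} {f : ℍ → ℂ} (hf : f ∣[k] ModularGroup.T = f) {a b : ℤ}
    (hab : (a : ZMod t) = b) (z : ℍ) : f (shift t a z) = f (shift t b z) := by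
  obtain ⟨c, hc⟩ := (Int.modEq_iff_dvd.mp ((ZMod.intCast_eq_intCast_iff _ _ _).mp hab))
  have ht : (t : ℂ) ≠ 0 := NeZero.ne _
  have hc' : (b : ℂ) - a = t * c := by exact_mod_cast hc
  refine (apply_eq_of_coe_eq_add_intCast hf c ?_).symm
  rw [coe_shift, coe_shift]
  field_simp
  linear_combination hc'

theorem twentyFour_ne_zero (ht : t.Coprime 12) : (24 : ZMod t) ≠ 0 := by
  have h12 : IsUnit (12 : ZMod t) := by simpa using (ZMod.isUnit_iff_coprime 12 t).mpr ht.symm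
  have h2 : IsUnit (2 : ZMod t) := by
    simpa using (ZMod.isUnit_iff_coprime 2 t).mpr
      (Nat.Coprime.coprime_dvd_right (by norm_num) ht).symm
  rw [show (24 : ZMod t) = 12 * 2 by norm_num]
  exact (h12.mul h2).ne_zero

/-- `z ↦ (n b - 1/z) / n` is the composite of an element of `Γ₀(n)` and a translate of `z / n`. -/
theorem exists_shift_S_smul (n : ℕ) [NeZero n] {b c : ℤ} (hbc : (n : ℤ) ∣ b * c + 1) :
    ∃ γ ∈ CongruenceSubgroup.Gamma0 n, (γ 1 0 : ℤ) = n ∧ (γ 1 1 : ℤ) = -c ∧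
      ∀ z : ℍ, shift n b (ModularGroup.S • z) = γ • shift n c z := by
  obtain ⟨d, hd⟩ := hbc
  let γ : SL(2, ℤ) := ⟨!![b, -d; n, -c], by
    rw [Matrix.det_fin_two_of]
    linear_combination -hd⟩
  have h00 : γ 0 0 = b := rfl
  have h01 : γ 0 1 = -d := rfl
  have h10 : γ 1 0 = n := rfl
  have h11 : γ 1 1 = -c := rfl
  refine ⟨γ, by simp [CongruenceSubgroup.Gamma0_mem, h10], h10, h11, fun z ↦ ?_⟩
  have hn : (n : ℂ) ≠ 0 := NeZero.ne _
  have hz : (z : ℂ) ≠ 0 := z.ne_zero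
  have hd' : (b : ℂ) * c + 1 = n * d := by exact_mod_cast hd
  ext
  rw [coe_shift, coe_S_smul, UpperHalfPlane.coe_specialLinearGroup_apply, coe_shift, h00, h01, h10,
    h11]
  simp only [algebraMap_int_eq, eq_intCast, Complex.ofReal_intCast]
  push_cast
  rw [show (n : ℂ) * ((z + c) / n) + -c = z by field_simp; ring]
  field_simp
  linear_combination -hd'

theorem formShift_T (ht : t.Coprime 12) (hG : ∀ γ ∈ CongruenceSubgroup.Gamma0 t, G ∣[(2 : ℤ)] γ = G)
    (v : Fin 2 → ZMod t) :
    formShift t G v ∣[(2 : ℤ)] ModularGroup.T = formShift t G (rowAct ModularGroup.T v) := by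
  have hTG := hG _ (T_mem_Gamma0 t)
  have h24 := twentyFour_ne_zero ht
  have h0 : rowAct ModularGroup.T v 0 = v 0 := by simp [rowAct_zero_apply, ModularGroup.coe_T]
  have h1 : rowAct ModularGroup.T v 1 = v 0 + v 1 := by simp [rowAct_one_apply, ModularGroup.coe_T]
  refine slash_eq_of_smul_apply fun z ↦ ?_
  rw [show ModularGroup.T 1 0 = 0 from rfl, show ModularGroup.T 1 1 = 1 from rfl, formShift,
    formShift, h0, h1]
  simp only [Int.cast_zero, Int.cast_one, zero_mul, zero_add, one_zpow, one_mul]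
  split_ifs with hv0
  · congr 1
    -- At tz the translation T acts as T^t, and S T^t S⁻¹ lies in Γ₀(t), so G ∣ S is unchanged.
    have hmem : ModularGroup.S * ModularGroup.T ^ t * ModularGroup.S⁻¹ ∈
        CongruenceSubgroup.Gamma0 t := by
      rw [CongruenceSubgroup.Gamma0_mem]
      have := ModularGroup.coe_T_zpow t
      rw [zpow_natCast] at this
      simp [Matrix.SpecialLinearGroup.coe_mul, this, ModularGroup.coe_S, Matrix.mul_apply,
        Fin.sum_univ_two, Matrix.adjugate_fin_two]
    have hinv : (G ∣[(2 : ℤ)] ModularGroup.S) ∣[(2 : ℤ)] (ModularGroup.T ^ t) =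
        G ∣[(2 : ℤ)] ModularGroup.S := by
      conv_rhs => rw [← hG _ hmem]
      simp only [← SlashAction.slash_mul]
      rw [inv_mul_cancel_right]
    have hsc : scale t (ModularGroup.T • z) = ModularGroup.T ^ t • scale t z := by
      ext
      have := UpperHalfPlane.modular_T_zpow_smul (scale t z) t
      rw [zpow_natCast] at this
      rw [this, coe_scale, coe_T_smul]
      simp
      ring
    rw [hsc]
    have hT := smul_apply_of_slash_eq hinv (scale t z)
    have hTm := ModularGroup.coe_T_zpow t
    rw [zpow_natCast] at hTm
    rw [hT, hTm]
    simp
  -- Adding v₀ to v₁ adds 1 to v₁/v₀, the residue of the shift modulo t.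
  · have hsh : shift t (24 * (v 1 / (24 * v 0)).val) (ModularGroup.T • z) =
        shift t (24 * (v 1 / (24 * v 0)).val + 1) z := by
      ext
      rw [coe_shift, coe_shift, coe_T_smul]
      push_cast
      ring
    rw [hsh]
    refine apply_shift_congr hTG ?_ z
    push_cast
    simp only [ZMod.natCast_val, ZMod.cast_id', id]
    field_simp
    ring

theorem formShift_S (ht : t.Coprime 12) (hG : ∀ γ ∈ CongruenceSubgroup.Gamma0 t, G ∣[(2 : ℤ)] γ = G)
    {v : Fin 2 → ZMod t} (hv : v ≠ 0) :
    formShift t G v ∣[(2 : ℤ)] ModularGroup.S = formShift t G (rowAct ModularGroup.S v) := by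
  have h24 := twentyFour_ne_zero ht
  have htC : (t : ℂ) ≠ 0 := NeZero.ne _
  have h0 : rowAct ModularGroup.S v 0 = v 1 := by simp [rowAct_zero_apply, ModularGroup.coe_S]
  have h1 : rowAct ModularGroup.S v 1 = -v 0 := by simp [rowAct_one_apply, ModularGroup.coe_S]
  have hGS (w : ℍ) := S_smul_apply_of_slash_eq (f := G) (k := 2) rfl w
  refine slash_eq_of_smul_apply fun z ↦ ?_
  have hz : (z : ℂ) ≠ 0 := z.ne_zero
  rw [show ModularGroup.S 1 0 = 1 from rfl, show ModularGroup.S 1 1 = 0 from rfl, formShift,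
    formShift, h0, h1]
  simp only [Int.cast_zero, Int.cast_one, add_zero, one_mul]
  by_cases hv0 : v 0 = 0
  · have hv1 : v 1 ≠ 0 := fun h ↦ hv (by ext i; fin_cases i <;> simp [hv0, h])
    rw [if_pos hv0, if_neg hv1, scale_S_smul, hv0]
    simp only [neg_zero, zero_div, ZMod.val_zero, Nat.cast_zero, mul_zero]
    have hSS : ModularGroup.S • ModularGroup.S • shift t 0 z = shift t 0 z := by
      ext
      rw [coe_S_smul, coe_S_smul]
      simp
    have h := hGS (ModularGroup.S • shift t 0 z)
    rw [hSS, coe_S_smul, coe_shift, zpow_ofNat] at h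
    rw [h, zpow_ofNat, Int.cast_zero, add_zero]
    field_simp
  · rw [if_neg hv0]
    by_cases hv1 : v 1 = 0
    · rw [if_pos hv1, hv1]
      simp only [zero_div, ZMod.val_zero, Nat.cast_zero, mul_zero]
      rw [shift_zero_S_smul, hGS, coe_scale, zpow_ofNat, zpow_ofNat]
      ring
    · rw [if_neg hv1]
      -- Modulo t the two shifts are v₁/v₀ and -v₀/v₁, with product -1.
      obtain ⟨γ, hγ, h10, h11, hsm⟩ := exists_shift_S_smul t
        (b := 24 * (v 1 / (24 * v 0)).val) (c := 24 * (-v 0 / (24 * v 1)).val) (by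
          rw [← ZMod.intCast_zmod_eq_zero_iff_dvd]
          push_cast
          simp only [ZMod.natCast_val, ZMod.cast_id', id]
          field_simp
          ring)
      rw [hsm, smul_apply_of_slash_eq (hG γ hγ), coe_shift, h10, h11]
      congr 2
      push_cast
      field_simp
      ring

/-- The generators suffice because nonzero rows stay nonzero. The zero row must be excluded: it is
fixed by the action, while the value assigned to it by default does not transform this way under S.
-/
theorem formShift_slash (ht : t.Coprime 12)
    (hG : ∀ γ ∈ CongruenceSubgroup.Gamma0 t, G ∣[(2 : ℤ)] γ = G) (γ : SL(2, ℤ))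
    {v : Fin 2 → ZMod t} (hv : v ≠ 0) :
    formShift t G v ∣[(2 : ℤ)] γ = formShift t G (rowAct γ v) := by
  induction γ using SL2Z_induction generalizing v with
  | hone => rw [SlashAction.slash_one, rowAct_one]
  | hS => exact formShift_S ht hG hv
  | hT => exact formShift_T ht hG v
  | hmul γ δ hγ hδ => rw [SlashAction.slash_mul, hγ hv, hδ (rowAct_ne_zero γ hv), rowAct_mul]
  | hinv γ hγ =>
    have h := hγ (rowAct_ne_zero γ⁻¹ hv)
    rw [← rowAct_mul, inv_mul_cancel, rowAct_one] at h
    rw [← h, ← SlashAction.slash_mul, mul_inv_cancel, SlashAction.slash_one]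

theorem mdifferentiable_formShift (hG : MDifferentiable 𝓘(ℂ) 𝓘(ℂ) G) (v : Fin 2 → ZMod t) :
    MDifferentiable 𝓘(ℂ) 𝓘(ℂ) (formShift t G v) := by
  unfold formShift
  split_ifs
  · have h := mdifferentiable_comp_scale (hG.slash 2 (ModularGroup.S : GL (Fin 2) ℝ)) t
    rw [UpperHalfPlane.mdifferentiable_iff] at h ⊢
    exact h.const_mul ((t : ℂ) ^ 2)
  · exact mdifferentiable_comp_shift hG t _

theorem isMeromorphicAtImInfty_formShift (hG : IsMeromorphicAtImInfty G)
    (hGS : IsMeromorphicAtImInfty (G ∣[(2 : ℤ)] ModularGroup.S)) (v : Fin 2 → ZMod t) :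
    IsMeromorphicAtImInfty (formShift t G v) := by
  unfold formShift
  split_ifs
  · exact (hGS.comp_scale t).const_mul _
  · exact hG.comp_shift t _

end formShift

/-! ### The translates of `η` under matrices of determinant `t` -/

theorem eta_add_intCast (n : ℤ) (z : ℂ) :
    ModularForm.eta (z + n) = Complex.exp (2 * π * Complex.I * n / 24) * ModularForm.eta z := by
  have h1 : Function.Periodic.qParam 24 (z + n) =
      Complex.exp (2 * π * Complex.I * n / 24) * Function.Periodic.qParam 24 z := by
    rw [Function.Periodic.qParam, Function.Periodic.qParam, ← Complex.exp_add]
    congr 1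
    push_cast
    ring
  have h2 : Function.Periodic.qParam 1 (z + n) = Function.Periodic.qParam 1 z := by
    rw [Function.Periodic.qParam, Function.Periodic.qParam, Complex.exp_eq_exp_iff_exists_int]
    exact ⟨n, by push_cast; ring⟩
  simp only [ModularForm.eta, ModularForm.eta_q, h1, h2, mul_assoc]

/-- The constant relating `η(t z)` to the functions `η((z + 24 a) / t)`. -/
def etaConst (t : ℕ) [Fact t.Prime] : ℂ := legendreChar t 24 * chi12 t * quadGauss t

/-- The functions `((u / t)) η((z + 24 a) / t)` and their companion `η(t z)`, indexed by the row
vectors `(u, v)` modulo `t`, with `24 a u = v`, and normalised so that they are permuted by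
`SL(2, ℤ)` up to a common factor of automorphy. -/
def etaVec (t : ℕ) [Fact t.Prime] (v : Fin 2 → ZMod t) (z : ℍ) : ℂ :=
  if v 0 = 0 then etaConst t * legendreChar t (v 1) * ModularForm.eta (scale t z)
  else legendreChar t (v 0) * ModularForm.eta (shift t (24 * (v 1 / (24 * v 0)).val) z)

/-- This makes the multiplier of η(tz) under T agree with that of the functions η((z + 24a)/t). -/
theorem sq_modEq_one {t : ℕ} (ht : t.Coprime 12) : (t : ℤ) ^ 2 ≡ 1 [ZMOD 24] := by
  have h : (t : ZMod 24) ^ 2 = 1 := by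
    have hu : IsUnit (t : ZMod 24) := (ZMod.isUnit_iff_coprime t 24).mpr
      (Nat.Coprime.mul_right ht (Nat.Coprime.coprime_dvd_right (by norm_num) ht : t.Coprime 2))
    generalize (t : ZMod 24) = r at hu
    revert r
    decide
  exact (ZMod.intCast_eq_intCast_iff _ _ 24).mp (by exact_mod_cast h)

section etaVec

variable {t : ℕ} [Fact t.Prime]

theorem coprime_twelve (ht : 5 ≤ t) : t.Coprime 12 := by
  have hp : t.Prime := Fact.out
  have h3 : ¬ t ∣ 12 := fun h ↦ by
    have h' : t ∣ 2 * 2 * 3 := h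
    rcases hp.dvd_mul.mp h' with h' | h'
    · rcases hp.dvd_mul.mp h' with h' | h' <;> have := Nat.le_of_dvd two_pos h' <;> omega
    · have := Nat.le_of_dvd (by norm_num) h'; omega
  exact (Nat.Prime.coprime_iff_not_dvd hp).mpr h3

theorem ne_two_of_coprime_twelve (ht : t.Coprime 12) : t ≠ 2 := by
  rintro rfl
  revert ht
  decide

theorem etaConst_ne_zero (ht : t.Coprime 12) : etaConst t ≠ 0 := by
  have hc : (chi12 t : ℂ) ^ 2 = 1 := by exact_mod_cast chi12_sq ht
  refine mul_ne_zero (mul_ne_zero (legendreChar_ne_zero (twentyFour_ne_zero ht)) fun h ↦ ?_)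
    (quadGauss_ne_zero (ne_two_of_coprime_twelve ht))
  simp [h] at hc

theorem etaConst_sq (ht : t.Coprime 12) : etaConst t ^ 2 = legendreChar t (-1) * t := by
  have hc : (chi12 t : ℂ) ^ 2 = 1 := by exact_mod_cast chi12_sq ht
  have h24 := legendreChar_mul_self (twentyFour_ne_zero ht)
  rw [etaConst, mul_pow, mul_pow, hc, sq (legendreChar t 24), h24,
    quadGauss_sq (ne_two_of_coprime_twelve ht)]
  ring

theorem etaVec_ne_zero (ht : t.Coprime 12) {v : Fin 2 → ZMod t} (hv : v ≠ 0) (z : ℍ) :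
    etaVec t v z ≠ 0 := by
  unfold etaVec
  split_ifs with h0
  · have h1 : v 1 ≠ 0 := fun h ↦ hv (by ext i; fin_cases i <;> simp [h0, h])
    exact mul_ne_zero (mul_ne_zero (etaConst_ne_zero ht) (legendreChar_ne_zero h1))
      (ModularForm.eta_ne_zero (scale t z).im_pos)
  · exact mul_ne_zero (legendreChar_ne_zero h0) (ModularForm.eta_ne_zero (shift t _ z).im_pos)

theorem etaVec_T (ht : t.Coprime 12) (v : Fin 2 → ZMod t) (z : ℍ) :
    etaVec t v (ModularGroup.T • z) =
      Complex.exp (2 * π * Complex.I * t / 24) * etaVec t (rowAct ModularGroup.T v) z := by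
  have h24 := twentyFour_ne_zero ht
  have htC : (t : ℂ) ≠ 0 := NeZero.ne _
  have h0 : rowAct ModularGroup.T v 0 = v 0 := by simp [rowAct_zero_apply, ModularGroup.coe_T]
  have h1 : rowAct ModularGroup.T v 1 = v 0 + v 1 := by
    simp [rowAct_one_apply, ModularGroup.coe_T]
  rw [etaVec, etaVec, h0, h1]
  split_ifs with hv0
  · rw [hv0, zero_add, coe_scale, coe_T_smul, mul_add, mul_one, coe_scale]
    have := eta_add_intCast t (t * z)
    rw [Int.cast_natCast] at this
    rw [this]
    ring
  · rw [coe_shift, coe_shift, coe_T_smul]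
    set a := v 1 / (24 * v 0) with ha
    set a' := (v 0 + v 1) / (24 * v 0) with ha'
    have hmod : (t : ℤ) ∣ 24 * a'.val - 24 * a.val - 1 := by
      rw [← ZMod.intCast_zmod_eq_zero_iff_dvd]
      push_cast
      simp only [ZMod.natCast_val, ZMod.cast_id', id, ha, ha']
      field_simp
      ring
    obtain ⟨k, hk⟩ := hmod
    -- The leftover translation is by -k. From tk ≡ -1 and t² ≡ 1 modulo 24 it follows that k ≡ -t,
    -- so the multiplier is exp(2πit/24).
    have hk24 : (24 : ℤ) ∣ k + t := by
      have h1 : (24 : ℤ) ∣ t * (t * k + 1) := Dvd.dvd.mul_left ⟨(a'.val : ℤ) - a.val, by linarith⟩ _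
      have h2 := (Int.modEq_iff_dvd.mp (sq_modEq_one ht)).mul_right k
      have : k + t = t * (t * k + 1) + (1 - (t : ℤ) ^ 2) * k := by ring
      rw [this]
      exact dvd_add h1 h2
    obtain ⟨l, hl⟩ := hk24
    have hkC : (24 * a'.val - 24 * a.val - 1 : ℂ) = t * k := by exact_mod_cast hk
    have hlC : (k : ℂ) + t = 24 * l := by exact_mod_cast hl
    have harg : ((z : ℂ) + 1 + (24 * a.val : ℤ)) / t =
        (z + (24 * a'.val : ℤ)) / t + (-k : ℤ) := by
      push_cast
      field_simp
      linear_combination -hkC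
    have hexp : Complex.exp (2 * π * Complex.I * (-k : ℤ) / 24) =
        Complex.exp (2 * π * Complex.I * t / 24) := by
      rw [Complex.exp_eq_exp_iff_exists_int]
      refine ⟨-l, ?_⟩
      push_cast
      linear_combination (-2 * π * Complex.I / 24) * hlC
    rw [harg, eta_add_intCast, hexp]
    ring

/-- Rows on a coordinate axis follow from the inversion of η, all others from `etaShift_neg_inv`. A
single factor serves every row because the square of `etaConst` is χ(-1)t, which matches the passage
from η(z/t) to η(tz) with the reverse one. -/
theorem etaVec_S (ht : t.Coprime 12) {v : Fin 2 → ZMod t} (hv : v ≠ 0) (z : ℍ) :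
    etaVec t v (ModularGroup.S • z) =
      etaConst t / (√t : ℝ) * (-Complex.I * z) ^ (1 / 2 : ℂ) *
        etaVec t (rowAct ModularGroup.S v) z := by
  have h24 := twentyFour_ne_zero ht
  have htp : (0 : ℝ) < t := by exact_mod_cast (Fact.out : t.Prime).pos
  have htC : (t : ℂ) ≠ 0 := NeZero.ne _
  have hst : ((√t : ℝ) : ℂ) ≠ 0 := by exact_mod_cast (Real.sqrt_pos.mpr htp).ne'
  have hst2 : ((√t : ℝ) : ℂ) ^ 2 = t := by exact_mod_cast Real.sq_sqrt htp.le
  have hκ := etaConst_sq ht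
  have hneg := legendreChar_mul_self (t := t) (a := -1) (by simp)
  have h0 : rowAct ModularGroup.S v 0 = v 1 := by simp [rowAct_zero_apply, ModularGroup.coe_S]
  have h1 : rowAct ModularGroup.S v 1 = -v 0 := by simp [rowAct_one_apply, ModularGroup.coe_S]
  rw [etaVec, etaVec, h0, h1]
  by_cases hv0 : v 0 = 0
  · have hv1 : v 1 ≠ 0 := fun h ↦ hv (by ext i; fin_cases i <;> simp [hv0, h])
    rw [if_pos hv0, if_neg hv1, scale_S_smul, coe_S_smul, eta_neg_inv (shift t 0 z).im_pos, hv0]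
    simp only [neg_zero, zero_div, ZMod.val_zero, Nat.cast_zero, mul_zero]
    have h := neg_I_mul_ofReal_mul_cpow htp (shift t 0 z).ne_zero
    have hz : ((t : ℝ) : ℂ) * shift t 0 z = z := by
      rw [coe_shift]
      push_cast
      field_simp
      ring
    rw [hz] at h
    rw [h]
    field_simp
  · rw [if_neg hv0]
    by_cases hv1 : v 1 = 0
    · rw [if_pos hv1, hv1]
      simp only [zero_div, ZMod.val_zero, Nat.cast_zero, mul_zero]
      rw [shift_zero_S_smul, coe_S_smul, eta_neg_inv (scale t z).im_pos, coe_scale]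
      have h := neg_I_mul_ofReal_mul_cpow htp z.ne_zero
      rw [Complex.ofReal_natCast] at h
      rw [h, neg_eq_neg_one_mul (v 0), map_mul]
      field_simp
      linear_combination legendreChar t (v 0) * (-(Complex.I * z)) ^ (1 / 2 : ℂ) *
        ModularForm.eta (z * t) * (hst2 - legendreChar t (-1) * hκ - t * hneg)
    · rw [if_neg hv1]
      set b := v 1 / (24 * v 0) with hb
      set a := -v 0 / (24 * v 1) with ha
      have hab : 576 * a * b = -1 := by
        rw [ha, hb]
        field_simp
        norm_num
      have key := etaShift_neg_inv ht hab z.im_pos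
      have hχa : legendreChar t a =
          legendreChar t (-1) * legendreChar t (v 0) * legendreChar t 24 * legendreChar t (v 1) := by
        rw [ha, div_eq_mul_inv, map_mul, legendreChar_inv, map_mul, neg_eq_neg_one_mul, map_mul]
        ring
      have hτ := quadGauss_ne_zero (ne_two_of_coprime_twelve ht)
      have hτ2 := quadGauss_sq (ne_two_of_coprime_twelve ht)
      have hv0' := legendreChar_mul_self hv0
      rw [etaShift, etaShift, hχa] at key
      rw [coe_shift, coe_S_smul, coe_shift]
      push_cast
      refine mul_left_cancel₀ hτ ?_
      rw [etaConst, mul_left_comm, key]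
      field_simp
      rw [hτ2, hst2, sq (legendreChar t (v 0)), hv0']
      ring

/-- Only independence of v and non-vanishing of j matter: j cancels in quotients, so its multiplier
system need never be computed. -/
theorem exists_etaVec_smul (ht : t.Coprime 12) (γ : SL(2, ℤ)) :
    ∃ j : ℍ → ℂ, ∀ v : Fin 2 → ZMod t, v ≠ 0 → ∀ z : ℍ,
      j z ≠ 0 ∧ etaVec t v (γ • z) = j z * etaVec t (rowAct γ v) z := by
  induction γ using SL2Z_induction with
  | hone => exact ⟨fun _ ↦ 1, fun v _ z ↦ ⟨one_ne_zero, by rw [one_smul, rowAct_one, one_mul]⟩⟩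
  | hS =>
    have htp : (0 : ℝ) < t := by exact_mod_cast (Fact.out : t.Prime).pos
    have hst : ((√t : ℝ) : ℂ) ≠ 0 := by exact_mod_cast (Real.sqrt_pos.mpr htp).ne'
    refine ⟨_, fun v hv z ↦ ⟨mul_ne_zero (div_ne_zero (etaConst_ne_zero ht) hst) ?_,
      etaVec_S ht hv z⟩⟩
    simp [Complex.cpow_eq_zero_iff, z.ne_zero]
  | hT => exact ⟨_, fun v _ z ↦ ⟨Complex.exp_ne_zero _, etaVec_T ht v z⟩⟩
  | hmul γ δ hγ hδ =>
    obtain ⟨j, hj⟩ := hγ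
    obtain ⟨k, hk⟩ := hδ
    refine ⟨fun z ↦ j (δ • z) * k z, fun v hv z ↦ ⟨mul_ne_zero (hj v hv _).1 (hk v hv z).1, ?_⟩⟩
    rw [mul_smul, (hj v hv _).2, (hk _ (rowAct_ne_zero γ hv) z).2, rowAct_mul, mul_assoc]
  | hinv γ hγ =>
    obtain ⟨j, hj⟩ := hγ
    refine ⟨fun z ↦ (j (γ⁻¹ • z))⁻¹, fun v hv z ↦ ⟨inv_ne_zero (hj v hv _).1, ?_⟩⟩
    have h := (hj _ (rowAct_ne_zero γ⁻¹ hv) (γ⁻¹ • z)).2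
    rw [← rowAct_mul, inv_mul_cancel, rowAct_one, smul_inv_smul] at h
    rw [h, inv_mul_cancel_left₀ (hj v hv _).1]

theorem mdifferentiable_etaVec (v : Fin 2 → ZMod t) :
    MDifferentiable 𝓘(ℂ) 𝓘(ℂ) (etaVec t v) := by
  unfold etaVec
  split_ifs
  · have h := mdifferentiable_comp_scale mdifferentiable_eta t
    rw [UpperHalfPlane.mdifferentiable_iff] at h ⊢
    exact h.const_mul (etaConst t * legendreChar t (v 1))
  · have h := mdifferentiable_comp_shift mdifferentiable_eta t (24 * (v 1 / (24 * v 0)).val)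
    rw [UpperHalfPlane.mdifferentiable_iff] at h ⊢
    exact h.const_mul (legendreChar t (v 0))

theorem isMeromorphicAtImInfty_etaVec (v : Fin 2 → ZMod t) :
    IsMeromorphicAtImInfty (etaVec t v) := by
  unfold etaVec
  split_ifs
  · exact (isMeromorphicAtImInfty_eta.comp_scale t).const_mul _
  · exact (isMeromorphicAtImInfty_eta.comp_shift t _).const_mul _

end etaVec

/-! ### The invariant sum over the translates -/

/-- The sum of `(v₁ / t) G_v η_(1,0) / η_v` over the row vectors `v = (v₀, v₁)` modulo `t`. -/
def shiftSum (t : ℕ) [Fact t.Prime] (G : ℍ → ℂ) (z : ℍ) : ℂ :=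
  ∑ v : Fin 2 → ZMod t,
    legendreChar t (v 1) * (formShift t G v z * etaVec t ![1, 0] z / etaVec t v z)

section shiftSum

variable {t : ℕ} [Fact t.Prime] {G : ℍ → ℂ}

theorem legendreChar_zero : legendreChar t 0 = 0 := MulChar.map_zero _

theorem shiftSum_slash (ht : t.Coprime 12)
    (hG : ∀ γ ∈ CongruenceSubgroup.Gamma0 t, G ∣[(2 : ℤ)] γ = G) (γ : SL(2, ℤ)) :
    shiftSum t G ∣[(2 : ℤ)] γ = fun z ↦ ∑ v : Fin 2 → ZMod t, legendreChar t (v 1) *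
      (formShift t G (rowAct γ v) z * etaVec t (rowAct γ ![1, 0]) z / etaVec t (rowAct γ v) z) := by
  obtain ⟨j, hj⟩ := exists_etaVec_smul (t := t) ht γ
  refine slash_eq_of_smul_apply fun z ↦ ?_
  rw [shiftSum, Finset.mul_sum]
  refine Finset.sum_congr rfl fun v _ ↦ ?_
  -- The zero row, for which no transformation law holds, has weight χ(0) = 0.
  rcases eq_or_ne v 0 with rfl | hv
  · simp [legendreChar_zero]
  · have he : (![1, 0] : Fin 2 → ZMod t) ≠ 0 := fun h ↦ by simpa using congrFun h 0
    have hjz := (hj v hv z).1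
    rw [smul_apply_of_slash_eq (formShift_slash ht hG γ hv), (hj v hv z).2, (hj _ he z).2]
    field_simp

/-- Modulo t such a γ is lower triangular with ad = 1. Hence (1,0)γ = (a,0) contributes χ(a),
reindexing v ↦ vγ replaces v₁ by d v₁, and χ(d) = χ(a). -/
theorem shiftSum_slash_eq_self (ht : t.Coprime 12)
    (hG : ∀ γ ∈ CongruenceSubgroup.Gamma0 t, G ∣[(2 : ℤ)] γ = G) {γ : SL(2, ℤ)}
    (hγ : (t : ℤ) ∣ γ 0 1) : shiftSum t G ∣[(2 : ℤ)] γ = shiftSum t G := by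
  have hB : ((γ 0 1 : ℤ) : ZMod t) = 0 := (ZMod.intCast_zmod_eq_zero_iff_dvd _ _).mpr hγ
  have hdet : ((γ 0 0 : ℤ) : ZMod t) * (γ 1 1 : ℤ) = 1 := by
    have h := congrArg (Int.cast (R := ZMod t)) ((Matrix.det_fin_two _).symm.trans γ.det_coe)
    push_cast at h
    rw [hB] at h
    simpa using h
  have hA : ((γ 0 0 : ℤ) : ZMod t) ≠ 0 := left_ne_zero_of_mul_eq_one hdet
  have hAD : legendreChar t (γ 1 1 : ℤ) = legendreChar t (γ 0 0 : ℤ) := by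
    rw [eq_inv_of_mul_eq_one_right hdet, legendreChar_inv]
  have he0 : rowAct γ (![1, 0] : Fin 2 → ZMod t) 0 = (γ 0 0 : ℤ) := by simp [rowAct_zero_apply]
  have he1 : rowAct γ (![1, 0] : Fin 2 → ZMod t) 1 = 0 := by simp [rowAct_one_apply, hB]
  have heta (z : ℍ) : etaVec t (rowAct γ ![1, 0]) z =
      legendreChar t (γ 0 0 : ℤ) * etaVec t ![1, 0] z := by
    rw [etaVec, etaVec, he0, he1]
    simp [hA]
  rw [shiftSum_slash ht hG γ]
  ext z
  rw [shiftSum]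
  refine Fintype.sum_bijective _ (rowAct_bijective γ) _ _ fun v ↦ ?_
  rw [heta, rowAct_one_apply, hB, mul_zero, zero_add, map_mul, hAD]
  ring

theorem mdifferentiable_shiftSum (ht : t.Coprime 12) (hG : MDifferentiable 𝓘(ℂ) 𝓘(ℂ) G) :
    MDifferentiable 𝓘(ℂ) 𝓘(ℂ) (shiftSum t G) := by
  refine mdifferentiable_finset_sum _ fun v _ ↦ ?_
  rcases eq_or_ne v 0 with rfl | hv
  · simpa [legendreChar_zero] using mdifferentiable_const
  · have h := mdifferentiable_div (f := fun z ↦ formShift t G v z * etaVec t ![1, 0] z) (by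
      have h1 := mdifferentiable_formShift hG v
      have h2 := mdifferentiable_etaVec (t := t) ![1, 0]
      rw [UpperHalfPlane.mdifferentiable_iff] at h1 h2 ⊢
      exact h1.mul h2) (mdifferentiable_etaVec v) (etaVec_ne_zero ht hv)
    rw [UpperHalfPlane.mdifferentiable_iff] at h ⊢
    exact h.const_mul (legendreChar t (v 1))

/-- Each slash only moves the row labels, so the behaviour of the finitely many translates at `i∞`
controls every cusp. -/
theorem isMeromorphicAtImInfty_shiftSum_slash (ht : t.Coprime 12)
    (hG : ∀ γ ∈ CongruenceSubgroup.Gamma0 t, G ∣[(2 : ℤ)] γ = G) (hG1 : IsMeromorphicAtImInfty G)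
    (hGS : IsMeromorphicAtImInfty (G ∣[(2 : ℤ)] ModularGroup.S)) (γ : SL(2, ℤ)) :
    IsMeromorphicAtImInfty (shiftSum t G ∣[(2 : ℤ)] γ) := by
  rw [shiftSum_slash ht hG]
  exact .sum _ fun v _ ↦ (((isMeromorphicAtImInfty_formShift hG1 hGS _).mul
    (isMeromorphicAtImInfty_etaVec _)).div (isMeromorphicAtImInfty_etaVec _)).const_mul _

/-- For `γ = (a b; c d)` with `n ∤ c`, a decomposition of `(n 0; 0 1) γ`. -/
theorem exists_scale_smul_eq_shift (γ : SL(2, ℤ)) (h : ¬ (t : ℤ) ∣ γ 1 0) :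
    ∃ (δ : SL(2, ℤ)) (k : ℤ), ∀ z : ℍ, scale t (γ • z) = δ • shift t k z ∧
      (t : ℂ) * ((δ 1 0 : ℂ) * shift t k z + δ 1 1) = (γ 1 0 : ℂ) * z + γ 1 1 := by
  have htC : (t : ℂ) ≠ 0 := NeZero.ne _
  have hc : ((γ 1 0 : ℤ) : ZMod t) ≠ 0 := by rwa [Ne, ZMod.intCast_zmod_eq_zero_iff_dvd]
  -- The choice k ≡ d/c modulo t makes d - ck divisible by t, so that δ is integral.
  obtain ⟨k, hk⟩ := ZMod.intCast_surjective (((γ 1 1 : ℤ) : ZMod t) / ((γ 1 0 : ℤ) : ZMod t))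
  have hdvd : (t : ℤ) ∣ γ 1 1 - γ 1 0 * k := by
    rw [← ZMod.intCast_zmod_eq_zero_iff_dvd]
    push_cast
    rw [hk, mul_div_cancel₀ _ hc, sub_self]
  obtain ⟨e, he⟩ := hdvd
  have hdet := γ.det_coe
  rw [Matrix.det_fin_two] at hdet
  let δ : SL(2, ℤ) := ⟨!![t * γ 0 0, γ 0 1 - γ 0 0 * k; γ 1 0, e], by
    rw [Matrix.det_fin_two_of]
    linear_combination hdet - γ 0 0 * he⟩
  have h00 : δ 0 0 = t * γ 0 0 := rfl
  have h01 : δ 0 1 = γ 0 1 - γ 0 0 * k := rfl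
  have h10 : δ 1 0 = γ 1 0 := rfl
  have h11 : δ 1 1 = e := rfl
  have heC : (γ 1 1 : ℂ) - γ 1 0 * k = t * e := by exact_mod_cast he
  refine ⟨δ, k, fun z ↦ ?_⟩
  have hden : (t : ℂ) * ((δ 1 0 : ℂ) * shift t k z + δ 1 1) = (γ 1 0 : ℂ) * z + γ 1 1 := by
    rw [h10, h11, coe_shift]
    field_simp
    linear_combination -heC
  refine ⟨?_, hden⟩
  have hd0 : ((γ 1 0 : ℂ) * z + γ 1 1) ≠ 0 := by
    simpa [UpperHalfPlane.denom] using UpperHalfPlane.denom_ne_zero γ z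
  have hd1 : ((δ 1 0 : ℂ) * shift t k z + δ 1 1) ≠ 0 := fun h ↦ hd0 (by rw [← hden, h, mul_zero])
  ext
  rw [coe_scale, UpperHalfPlane.coe_specialLinearGroup_apply,
    UpperHalfPlane.coe_specialLinearGroup_apply]
  simp only [algebraMap_int_eq, eq_intCast, Complex.ofReal_intCast]
  rw [← hden]
  field_simp
  rw [h00, h01, coe_shift]
  push_cast
  field_simp
  ring

/-- Rescaling `shiftSum` gives a weakly holomorphic modular form on `Γ₀(t)`. -/
theorem isWeaklyHolomorphicModularForm_shiftSum_scale (ht : t.Coprime 12)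
    (hGd : MDifferentiable 𝓘(ℂ) 𝓘(ℂ) G)
    (hG : ∀ γ ∈ CongruenceSubgroup.Gamma0 t, G ∣[(2 : ℤ)] γ = G) (hG1 : IsMeromorphicAtImInfty G)
    (hGS : IsMeromorphicAtImInfty (G ∣[(2 : ℤ)] ModularGroup.S)) (c : ℂ) :
    IsWeaklyHolomorphicModularForm (CongruenceSubgroup.Gamma0 t) 2
      fun z ↦ c * shiftSum t G (scale t z) := by
  have hmero := isMeromorphicAtImInfty_shiftSum_slash ht hG hG1 hGS
  have hinv (γ : SL(2, ℤ)) (hγ : (t : ℤ) ∣ γ 1 0) :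
      (fun z ↦ c * shiftSum t G (scale t z)) ∣[(2 : ℤ)] γ =
        fun z ↦ c * shiftSum t G (scale t z) := by
    obtain ⟨δ, -, h01, h10, h11, hδ⟩ := exists_conj_of_dvd γ hγ
    refine slash_eq_of_smul_apply fun z ↦ ?_
    have hc' : (γ 1 0 : ℂ) = t * δ 1 0 := by exact_mod_cast h10.symm
    rw [hδ, smul_apply_of_slash_eq (shiftSum_slash_eq_self ht hG (h01 ▸ dvd_mul_right _ _)),
      coe_scale, h11, hc']
    simp only [zpow_ofNat]
    ring
  refine ⟨?_, fun γ hγ ↦ hinv γ ?_, fun γ ↦ ?_⟩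
  · have h := mdifferentiable_comp_scale (mdifferentiable_shiftSum ht hGd) t
    rw [UpperHalfPlane.mdifferentiable_iff] at h ⊢
    exact h.const_mul c
  · rwa [CongruenceSubgroup.Gamma0_mem, ZMod.intCast_zmod_eq_zero_iff_dvd] at hγ
  · by_cases hγ : (t : ℤ) ∣ γ 1 0
    · rw [hinv γ hγ]
      have h := hmero 1
      rw [SlashAction.slash_one] at h
      exact (h.comp_scale t).const_mul c
    · obtain ⟨δ, k, hδ⟩ := exists_scale_smul_eq_shift γ hγ
      have htC : (t : ℂ) ≠ 0 := NeZero.ne _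
      have heq : (fun z ↦ c * shiftSum t G (scale t z)) ∣[(2 : ℤ)] γ =
          fun z ↦ c / t ^ 2 * (shiftSum t G ∣[(2 : ℤ)] δ) (shift t k z) := by
        refine slash_eq_of_smul_apply fun z ↦ ?_
        rw [(hδ z).1, smul_apply_of_slash_eq (f := shiftSum t G) (k := 2) rfl, ← (hδ z).2,
          zpow_ofNat, zpow_ofNat]
        field_simp
      rw [heq]
      exact ((hmero δ).comp_shift t k).const_mul _

/-- The sum over the row vectors modulo `t`, expressed through the lines they span. -/
theorem shiftSum_apply (ht : t.Coprime 12) (w : ℍ) :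
    shiftSum t G w = (t - 1) * ModularForm.eta (shift t 0 w) *
      (legendreChar t 24 * (∑ a : ZMod t, legendreChar t a *
          (G (shift t (24 * a.val) w) / ModularForm.eta (shift t (24 * a.val) w))) +
        t ^ 2 / etaConst t * ((G ∣[(2 : ℤ)] ModularGroup.S) (scale t w) /
          ModularForm.eta (scale t w))) := by
  have h24 := twentyFour_ne_zero ht
  have hκ := etaConst_ne_zero ht
  have he : etaVec t ![1, 0] w = ModularForm.eta (shift t 0 w) := by simp [etaVec]
  have hcard : ((Finset.univ.erase (0 : ZMod t)).card : ℂ) = t - 1 := by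
    rw [Finset.card_erase_of_mem (Finset.mem_univ _), Finset.card_univ, ZMod.card,
      Nat.cast_sub (Fact.out : t.Prime).one_le, Nat.cast_one]
  have hu (u : ZMod t) (hu : u ∈ Finset.univ.erase (0 : ZMod t)) :
      ∑ b : ZMod t, legendreChar t b *
        (formShift t G ![u, b] w * etaVec t ![1, 0] w / etaVec t ![u, b] w) =
      ModularForm.eta (shift t 0 w) * (legendreChar t 24 * ∑ a : ZMod t, legendreChar t a *
        (G (shift t (24 * a.val) w) / ModularForm.eta (shift t (24 * a.val) w))) := by
    have hu0 : u ≠ 0 := (Finset.mem_erase.mp hu).1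
    have h24u : 24 * u ≠ 0 := mul_ne_zero h24 hu0
    rw [Finset.mul_sum, Finset.mul_sum]
    symm
    -- With b = 24ua the shift parameter is a, and χ(b)/χ(u) = χ(24)χ(a) does not depend on u.
    refine Fintype.sum_bijective _ (mulLeft_bijective₀ (24 * u) h24u) _ _ fun a ↦ ?_
    have hdiv : 24 * u * a / (24 * u) = a := mul_div_cancel_left₀ a h24u
    have hχu := legendreChar_ne_zero hu0
    rw [he, formShift, etaVec]
    simp only [Matrix.cons_val_zero, Matrix.cons_val_one, if_neg hu0, hdiv, map_mul]
    field_simp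
  -- Here χ(b) cancels against the one inside `etaVec`, so the t - 1 rows with b ≠ 0 contribute
  -- equally.
  have h0 : ∑ b : ZMod t, legendreChar t b *
        (formShift t G ![0, b] w * etaVec t ![1, 0] w / etaVec t ![0, b] w) =
      (t - 1) * ModularForm.eta (shift t 0 w) * (t ^ 2 / etaConst t *
        ((G ∣[(2 : ℤ)] ModularGroup.S) (scale t w) / ModularForm.eta (scale t w))) := by
    rw [← Finset.add_sum_erase _ _ (Finset.mem_univ 0), legendreChar_zero, zero_mul, zero_add,
      ← hcard, mul_assoc, ← nsmul_eq_mul, ← Finset.sum_const]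
    refine Finset.sum_congr rfl fun b hb ↦ ?_
    have hχb := legendreChar_ne_zero (Finset.mem_erase.mp hb).1
    rw [he, formShift, etaVec]
    simp only [Matrix.cons_val_zero, Matrix.cons_val_one, if_true]
    field_simp
  rw [shiftSum, ← (finTwoArrowEquiv (ZMod t)).symm.sum_comp, Fintype.sum_prod_type,
    ← Finset.add_sum_erase _ _ (Finset.mem_univ 0)]
  simp only [finTwoArrowEquiv_symm_apply, Matrix.cons_val_one, Matrix.cons_val_zero]
  rw [h0, Finset.sum_congr rfl hu, Finset.sum_const, nsmul_eq_mul, hcard]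
  ring

end shiftSum

/-! ### Expansions and their twists -/

theorem qPow_eq (n : ℤ) (z : ℍ) :
    qPow n z = Function.Periodic.qParam 1 z ^ n * (Function.Periodic.qParam 24 z)⁻¹ := by
  rw [qPow, Function.Periodic.qParam, Function.Periodic.qParam, ← Complex.exp_int_mul,
    ← Complex.exp_neg, ← Complex.exp_add]
  congr 1
  push_cast
  ring

/-- A function that is meromorphic at `i∞` becomes bounded there on multiplication by a power of
`q`. -/
theorem IsMeromorphicAtImInfty.exists_isBoundedAtImInfty {f : ℍ → ℂ}
    (hf : IsMeromorphicAtImInfty f) :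
    ∃ M : ℕ, UpperHalfPlane.IsBoundedAtImInfty
      fun z : ℍ ↦ Function.Periodic.qParam 1 z ^ M * f z := by
  obtain ⟨h, hh, F, ⟨M, hF⟩, hfF⟩ := hf
  have hh0 : (h : ℂ) ≠ 0 := by exact_mod_cast hh.ne'
  -- If x^M F is analytic at 0, the extra power M(h - 1) brings the exponent up to Mh, and q_h^(Mh)
  -- = q^M.
  have hF' : ContinuousAt (fun x : ℂ ↦ x ^ (M * (h - 1)) * ((x - 0) ^ M • F x)) 0 :=
    ((continuous_pow _).continuousAt).mul hF.continuousAt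
  have hlim := hF'.tendsto.comp
    (UpperHalfPlane.qParam_tendsto_atImInfty (h := (h : ℝ)) (by exact_mod_cast hh))
  refine ⟨M, (hlim.isBigO_one ℝ).congr' ?_ .rfl⟩
  filter_upwards [hfF] with z hz
  have hq : Function.Periodic.qParam 1 (z : ℂ) = Function.Periodic.qParam h (z : ℂ) ^ h := by
    rw [Function.Periodic.qParam, Function.Periodic.qParam, ← Complex.exp_nat_mul]
    congr 1
    push_cast
    field_simp
  obtain ⟨k, rfl⟩ : ∃ k, h = k + 1 := ⟨h - 1, by omega⟩
  simp only [Function.comp_apply, smul_eq_mul, sub_zero, Nat.add_sub_cancel]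
  rw [hz, hq]
  ring

/-- A holomorphic function on `ℍ` of period `1` with at most a pole at `i∞` is the sum of a Laurent
series in `q`. -/
theorem exists_hasSum_qParam_zpow {f : ℍ → ℂ} (hf : MDifferentiable 𝓘(ℂ) 𝓘(ℂ) f)
    (hper : ∀ z, f (ModularGroup.T • z) = f z) (hmero : IsMeromorphicAtImInfty f) :
    ∃ β : ℤ → ℂ, (∃ m : ℤ, ∀ n < m, β n = 0) ∧
      ∀ z : ℍ, HasSum (fun n : ℤ ↦ β n * Function.Periodic.qParam 1 z ^ n) (f z) := by
  obtain ⟨M, hM⟩ := hmero.exists_isBoundedAtImInfty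
  set g : ℍ → ℂ := fun z ↦ Function.Periodic.qParam 1 z ^ M * f z with hg
  have hgd : MDifferentiable 𝓘(ℂ) 𝓘(ℂ) g := by
    rw [UpperHalfPlane.mdifferentiable_iff] at hf ⊢
    have hq : DifferentiableOn ℂ (fun z : ℂ ↦ Function.Periodic.qParam 1 z ^ M)
        UpperHalfPlane.upperHalfPlaneSet := by
      unfold Function.Periodic.qParam
      fun_prop
    refine (hq.mul hf).congr fun z hz ↦ ?_
    simp [hg, UpperHalfPlane.ofComplex_apply_of_im_pos hz]
  have hgper : Function.Periodic (g ∘ UpperHalfPlane.ofComplex) (1 : ℝ) :=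
    periodic_of_smul_T fun z ↦ by
      have h : Function.Periodic.qParam 1 ((z : ℂ) + 1) = Function.Periodic.qParam 1 z := by
        rw [Function.Periodic.qParam, Function.Periodic.qParam, Complex.exp_eq_exp_iff_exists_int]
        exact ⟨1, by push_cast; ring⟩
      simp only [hg, hper, coe_T_smul, h]
  have hsum := UpperHalfPlane.hasSum_qExpansion one_pos hgper hgd hM
  set c : ℕ → ℂ := fun m ↦ (UpperHalfPlane.qExpansion 1 g).coeff m
  refine ⟨fun n ↦ if n < -(M : ℤ) then 0 else c (n + M).toNat, ⟨-M, fun n hn ↦ if_pos hn⟩,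
    fun z ↦ ?_⟩
  have hinj : Function.Injective fun m : ℕ ↦ (m : ℤ) - M := fun a b hab ↦ by simpa using hab
  rw [← hinj.hasSum_iff]
  · have hq0 : Function.Periodic.qParam 1 (z : ℂ) ≠ 0 := Function.Periodic.qParam_ne_zero _
    have h := (hsum z).mul_left (Function.Periodic.qParam 1 (z : ℂ) ^ (-(M : ℤ)))
    convert! h using 1
    · ext m
      have h1 : ¬ ((m : ℤ) - M < -(M : ℤ)) := by omega
      have h2 : ((m : ℤ) - M + M).toNat = m := by simp
      simp only [Function.comp_apply]
      rw [if_neg h1, h2, sub_eq_add_neg, zpow_add₀ hq0, zpow_natCast, smul_eq_mul]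
      ring
    · simp only [hg, zpow_neg, zpow_natCast]
      field_simp
  · intro n hn
    have h1 : n < -(M : ℤ) := by
      by_contra h
      exact hn ⟨(n + M).toNat, by simp; omega⟩
    simp [h1]

section twist

variable {t : ℕ} [Fact t.Prime]

theorem shift_scale_mul_val (a : ZMod t) (z : ℍ) :
    (shift t (24 * a.val) (scale t z) : ℂ) = z + 24 * a.val / t := by
  have htC : (t : ℂ) ≠ 0 := NeZero.ne _
  rw [coe_shift, coe_scale]
  push_cast
  field_simp

theorem shift_zero_scale (z : ℍ) : shift t 0 (scale t z) = z := by
  have htC : (t : ℂ) ≠ 0 := NeZero.ne _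
  ext
  rw [coe_shift, coe_scale, Int.cast_zero, add_zero, mul_div_cancel_left₀ _ htC]

/-- The exponent (n - 1/24)·24a/t equals (24n - 1)a/t, so the shift multiplies each term by an
additive character modulo t. -/
theorem qPow_shift (n : ℤ) (a : ZMod t) (z : ℍ) :
    qPow n (shift t (24 * a.val) (scale t z)) =
      qPow n z * ZMod.stdAddChar (((24 * n - 1 : ℤ) : ZMod t) * a) := by
  have htC : (t : ℂ) ≠ 0 := NeZero.ne _
  have ha : ((24 * n - 1 : ℤ) : ZMod t) * a = (((24 * n - 1) * a.val : ℤ) : ZMod t) := by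
    push_cast
    rw [ZMod.natCast_zmod_val]
  rw [ha, ZMod.stdAddChar_coe, qPow, qPow, shift_scale_mul_val, ← Complex.exp_add]
  congr 1
  push_cast
  field_simp

/-- Twisting an expansion by the quadratic character amounts to a weighted average over
translates. -/
theorem hasSum_twistedTerm (ht : t ≠ 2) {f : ℍ → ℂ} {β : ℤ → ℂ} (hβ : HasExpansion f β) (z : ℍ) :
    HasSum (twistedTerm t β z) (legendreChar t (-1) * (quadGauss t)⁻¹ *
      ∑ a : ZMod t, legendreChar t a * f (shift t (24 * a.val) (scale t z))) := by
  have hτ := quadGauss_ne_zero ht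
  have h := (hasSum_sum (s := Finset.univ) fun (a : ZMod t) _ ↦
    (hβ.2 (shift t (24 * a.val) (scale t z))).mul_left (legendreChar t a)).mul_left
      (legendreChar t (-1) * (quadGauss t)⁻¹)
  convert! h using 1
  ext n
  -- The average naturally produces the symbol of 24n - 1; the factor χ(-1) restores 1 - 24n.
  have hn : ((1 - 24 * n : ℤ) : ZMod t) = -1 * ((24 * n - 1 : ℤ) : ZMod t) := by
    push_cast
    ring
  have hs := sum_legendreChar_mul_stdAddChar ht ((24 * n - 1 : ℤ) : ZMod t)
  rw [twistedTerm, legendreSym_eq_legendreChar, hn, map_mul]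
  calc legendreChar t (-1) * legendreChar t ((24 * n - 1 : ℤ) : ZMod t) * β n * qPow n z
      = legendreChar t (-1) * (quadGauss t)⁻¹ * (β n * qPow n z *
          (legendreChar t ((24 * n - 1 : ℤ) : ZMod t) * quadGauss t)) := by
        field_simp
    _ = _ := by
        rw [← hs, Finset.mul_sum]
        congr 1
        refine Finset.sum_congr rfl fun a _ ↦ ?_
        rw [qPow_shift]
        ring

end twist

/-! ### The form `S` -/

section main

variable {t : ℕ} [Fact t.Prime] {K : ℍ → ℂ}

theorem star_apply_eq (z : ℍ) : star t K z = K (ModularGroup.S • scale t z) := by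
  obtain ⟨w, hw, h⟩ := star_apply t K z
  rw [h]
  congr 1
  ext
  rw [hw, coe_S_smul, coe_scale]

/-- Up to scaling, 𝓔_{2,t} is an eigenform of W_t with eigenvalue -1; this is the source of the
minus sign in `S_eq_shiftSum`. -/
theorem eisensteinTwo_slash_S_scale (z : ℍ) :
    (eisensteinTwo t ∣[(2 : ℤ)] ModularGroup.S) (scale t z) = -eisensteinTwo t z / t := by
  have htC : (t : ℂ) ≠ 0 := NeZero.ne _
  rw [eisensteinTwo_slash_S]
  simp only [shift_zero_scale]
  rw [eisensteinTwo]
  field_simp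
  ring

theorem eisensteinTwo_mul_slash (γ : SL(2, ℤ)) :
    (fun z ↦ eisensteinTwo t z * K z) ∣[(2 : ℤ)] γ =
      fun z ↦ (eisensteinTwo t ∣[(2 : ℤ)] γ) z * (K ∣[(0 : ℤ)] γ) z :=
  ModularForm.mul_slash_SL2 2 0 γ (eisensteinTwo t) K

/-- The factor t - 1 removes the multiplicity of each line. The rest of the constant is fixed by the
K* term, where t²/`etaConst` meets -1/t; the twisted term then matches because the squared Gauss sum
is χ(-1)t. -/
theorem S_eq_shiftSum (ht : t.Coprime 12) {β : ℤ → ℂ}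
    (hβ : HasExpansion (fun z ↦ eisensteinTwo t z * (K z / ModularForm.eta z)) β) :
    S t K β = fun z ↦ -(etaConst t / (t * (t - 1))) *
      shiftSum t (fun z ↦ eisensteinTwo t z * K z) (scale t z) := by
  have ht2 := ne_two_of_coprime_twelve ht
  have htC : (t : ℂ) ≠ 0 := NeZero.ne _
  have ht1 : (t : ℂ) - 1 ≠ 0 := sub_ne_zero.mpr (by exact_mod_cast (Fact.out : t.Prime).one_lt.ne')
  have hτ := quadGauss_ne_zero ht2
  have hτ2 := quadGauss_sq ht2
  have hκ := etaConst_ne_zero ht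
  have h24 := legendreChar_mul_self (twentyFour_ne_zero ht)
  have hneg := legendreChar_mul_self (t := t) (a := -1) (by simp)
  ext z
  have hK0 : (K ∣[(0 : ℤ)] ModularGroup.S) (scale t (scale t z)) = star t K (scale t z) := by
    rw [star_apply_eq, smul_apply_of_slash_eq (f := K) (k := 0) rfl, zpow_zero, one_mul]
  have hy : ModularForm.eta ((t : ℂ) ^ 2 * z) = ModularForm.eta (scale t (scale t z)) := by
    rw [coe_scale, coe_scale]
    ring_nf
  rw [shiftSum_apply ht, shift_zero_scale, eisensteinTwo_mul_slash, S,
    (hasSum_twistedTerm ht2 hβ z).tsum_eq, hy]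
  simp only [hK0, eisensteinTwo_slash_S_scale, ← mul_div_assoc]
  set A := ∑ a : ZMod t, legendreChar t a *
    (eisensteinTwo t (shift t (24 * a.val) (scale t z)) *
      K (shift t (24 * a.val) (scale t z))) /
        ModularForm.eta (shift t (24 * a.val) (scale t z))
  have hκτ : etaConst t * legendreChar t 24 * quadGauss t =
      chi12 t * legendreChar t (-1) * t := by
    rw [etaConst]
    linear_combination (chi12 t : ℂ) * hτ2 + chi12 t * quadGauss t ^ 2 * h24
  have hη (z : ℍ) : ModularForm.eta z ≠ 0 := ModularForm.eta_ne_zero z.im_pos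
  have hz := hη (scale t (scale t z))
  have hlin : etaConst t * legendreChar t 24 / t =
      chi12 t * legendreChar t (-1) * (quadGauss t)⁻¹ := by
    field_simp
    linear_combination hκτ
  calc _ = eisensteinTwo t (scale t z) * star t K (scale t z) *
        ModularForm.eta z / ModularForm.eta (scale t (scale t z)) -
          (chi12 t * legendreChar t (-1) * (quadGauss t)⁻¹) * ModularForm.eta z * A := by ring
    _ = _ := by
      rw [← hlin]
      field_simp
      ring

theorem isWeaklyHolomorphicModularForm_S (ht : t.Coprime 12)
    (hK : IsWeaklyHolomorphicModularForm (CongruenceSubgroup.Gamma0 t) 0 K) {β : ℤ → ℂ}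
    (hβ : HasExpansion (fun z ↦ eisensteinTwo t z * (K z / ModularForm.eta z)) β) :
    IsWeaklyHolomorphicModularForm (CongruenceSubgroup.Gamma0 t) 2 (S t K β) := by
  rw [S_eq_shiftSum ht hβ]
  have hK1 := hK.meromorphic_at_cusps 1
  rw [SlashAction.slash_one] at hK1
  refine isWeaklyHolomorphicModularForm_shiftSum_scale ht ?_ (fun γ hγ ↦ ?_)
    (isMeromorphicAtImInfty_eisensteinTwo.mul hK1) ?_ _
  · have h := mdifferentiable_eisensteinTwo (t := t)
    have h' := hK.holo
    rw [UpperHalfPlane.mdifferentiable_iff] at h h' ⊢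
    exact h.mul h'
  · rw [eisensteinTwo_mul_slash, eisensteinTwo_slash hγ, hK.slash_eq γ hγ]
  · rw [eisensteinTwo_mul_slash]
    exact isMeromorphicAtImInfty_eisensteinTwo_slash_S.mul (hK.meromorphic_at_cusps _)

theorem exists_hasExpansion
    (hK : IsWeaklyHolomorphicModularForm (CongruenceSubgroup.Gamma0 t) 0 K) :
    ∃ β, HasExpansion (fun z ↦ eisensteinTwo t z * (K z / ModularForm.eta z)) β := by
  have hK1 := hK.meromorphic_at_cusps 1
  rw [SlashAction.slash_one] at hK1
  have hη (z : ℍ) : ModularForm.eta z ≠ 0 :=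
    ModularForm.eta_ne_zero z.im_pos
  have hE := smul_apply_of_slash_eq (eisensteinTwo_slash (T_mem_Gamma0 t))
  have hKT := smul_apply_of_slash_eq (hK.slash_eq _ (T_mem_Gamma0 t))
  -- Multiplication by q^(1/24) cancels the multiplier of 1/η under T, leaving period 1 and a
  -- Laurent series in q.
  set f : ℍ → ℂ := fun z ↦ eisensteinTwo t z * (K z / ModularForm.eta z) *
    Function.Periodic.qParam 24 z with hf
  have hfd : MDifferentiable 𝓘(ℂ) 𝓘(ℂ) f := by
    have h := mdifferentiable_eisensteinTwo (t := t)
    have h' := mdifferentiable_div hK.holo mdifferentiable_eta hη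
    rw [UpperHalfPlane.mdifferentiable_iff] at h h' ⊢
    have hq : DifferentiableOn ℂ (fun z : ℂ ↦ Function.Periodic.qParam 24 z)
        UpperHalfPlane.upperHalfPlaneSet := by
      unfold Function.Periodic.qParam
      fun_prop
    refine ((h.mul h').mul hq).congr fun z hz ↦ ?_
    simp [hf, UpperHalfPlane.ofComplex_apply_of_im_pos hz]
  have hfT (z : ℍ) : f (ModularGroup.T • z) = f z := by
    have hη1 := eta_add_intCast 1 z
    simp only [Int.cast_one, mul_one] at hη1
    have hq1 : Function.Periodic.qParam 24 ((z : ℂ) + 1) =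
        Complex.exp (2 * π * Complex.I / 24) * Function.Periodic.qParam 24 z := by
      rw [Function.Periodic.qParam, Function.Periodic.qParam, ← Complex.exp_add]
      congr 1
      push_cast
      ring
    have h10 : ModularGroup.T 1 0 = 0 := rfl
    have h11 : ModularGroup.T 1 1 = 1 := rfl
    have he := Complex.exp_ne_zero (2 * π * Complex.I / 24)
    have hz := hη z
    simp only [hf]
    rw [hE, hKT, coe_T_smul, hq1, hη1, h10, h11]
    simp
    field_simp
  obtain ⟨β, hβ, hsum⟩ := exists_hasSum_qParam_zpow hfd hfT
    ((isMeromorphicAtImInfty_eisensteinTwo.mul (hK1.div isMeromorphicAtImInfty_eta)).mul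
      (.qParam 24 (by norm_num)))
  refine ⟨β, hβ, fun z ↦ ?_⟩
  have hq : Function.Periodic.qParam 24 (z : ℂ) ≠ 0 := Function.Periodic.qParam_ne_zero _
  convert! (hsum z).mul_right (Function.Periodic.qParam 24 (z : ℂ))⁻¹ using 1
  · ext n
    rw [qPow_eq, mul_assoc]
  · simp only [hf]
    field_simp

end main

end AtkinWeightTwo

end

theorem proposition3p1 (t : ℕ) [Fact t.Prime] (ht : 5 ≤ t) (K : UpperHalfPlane → ℂ)
    (hK : AtkinWeightTwo.IsWeaklyHolomorphicModularForm (CongruenceSubgroup.Gamma0 t) 0 K) :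
    (∃ β : ℤ → ℂ, AtkinWeightTwo.HasExpansion
      (fun z ↦ AtkinWeightTwo.eisensteinTwo t z * (K z / ModularForm.eta z)) β) ∧
    ∀ β : ℤ → ℂ, AtkinWeightTwo.HasExpansion
      (fun z ↦ AtkinWeightTwo.eisensteinTwo t z * (K z / ModularForm.eta z)) β →
      (∀ z : UpperHalfPlane, Summable (AtkinWeightTwo.twistedTerm t β z)) ∧
      AtkinWeightTwo.IsWeaklyHolomorphicModularForm (CongruenceSubgroup.Gamma0 t) 2
        (AtkinWeightTwo.S t K β) := by
  have h12 : t.Coprime 12 := AtkinWeightTwo.coprime_twelve ht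
  exact ⟨AtkinWeightTwo.exists_hasExpansion hK, fun β hβ ↦
    ⟨fun z ↦ (AtkinWeightTwo.hasSum_twistedTerm
      (AtkinWeightTwo.ne_two_of_coprime_twelve h12) hβ z).summable,
      AtkinWeightTwo.isWeaklyHolomorphicModularForm_S h12 hK hβ⟩⟩
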